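/- Fix $\lambda>0$. For $c_f,c_g>0$ and $k\neq 0$ let $f(y)=\frac{1}{2c_f}y^2$, $g(x)=\frac1{2c_g}x^2$, $h(x)=f(kx)+g(x)$, let $\mu^\ast=\mu^\ast_{c_f,c_g,k}$ be the probability measure on $\mathbb R$ with Lebesgue density proportional to $\exp(-h)$, and let $$A_{\mathrm{PD}}=\begin{pmatrix} c_g^{-1} & k\\ -\lambda k & \lambda c_f\end{pmatrix}.$$ For $B\in\mathbb R^{2\times 2}$ consider the primal-dual diffusion $\mathrm dZ_t=-A_{\mathrm{PD}}Z_t\,\mathrm dt+B\,\mathrm dW_t$ for $Z_t=(X_t,Y_t)\in\mathbb R^2$, where $W_t$ is Brownian motion in $\mathbb R^2$. A stationary solution of it is a probability measure $\pi$ on $\mathbb R^2$ such that the constant family $\pi_t=\pi$ solves the associated Fokker--Planck equation in the weak sense, i.e., with $\Sigma=\frac12BB^T$, $$\frac{\mathrm d}{\mathrm dt}\int\varphi\,\mathrm d\pi_t=\int\Big(\sum_{i,j}\Sigma_{ij}\,\partial_i\partial_j\varphi(z)-\nabla\varphi(z)\cdot A_{\mathrm{PD}}z\Big)\,\mathrm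 d\pi_t(z)\qquad\text{for all }\varphi\in C_c^\infty(\mathbb R^2),\ t\ge 0.$$ For every $B\in\mathbb R^{2\times2}$ and all $c_f,c_g>0$, $k\ne0$ there is exactly one stationary solution $\pi_\lambda$. However, there is no matrix $B\in\mathbb R^{2\times 2}$, chosen independently of $c_f$, $c_g$ and $k$ (it may depend on $\lambda$), such that for all $c_f,c_g>0$ and $k\neq0$ the stationary solution $\pi_\lambda$ has $x$-marginal $\mu^\ast_{c_f,c_g,k}$. -/

import Mathlib

open MeasureTheory Set
open scoped ContDiff Matrix

/-- The formal adjoint of the Fokker-Planck operator (the generator) of the diffusion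
`dZ = -A(Z) dt + B dW`, where `W` is a Brownian motion in `ℝ^κ` and `B` is a constant matrix:
`(L φ)(z) = ∑ i j, Σ i j * ∂ᵢ ∂ⱼ φ(z) - ∇φ(z) · A(z)` with `Σ = (1/2) B Bᵀ`. -/
noncomputable def diffusionGenerator {ι κ : Type*} [Fintype ι] [DecidableEq ι] [Fintype κ]
    (A : EuclideanSpace ℝ ι → EuclideanSpace ℝ ι) (B : Matrix ι κ ℝ)
    (φ : EuclideanSpace ℝ ι → ℝ) (z : EuclideanSpace ℝ ι) : ℝ :=
  (∑ i, ∑ j, ((1 / 2 : ℝ) • (B * Bᵀ)) i j *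
      fderiv ℝ (fun w => fderiv ℝ φ w (EuclideanSpace.single j 1)) z (EuclideanSpace.single i 1))
    - fderiv ℝ φ z (A z)

/-- The family `π t`, `t ≥ 0`, of probability measures is a (weak) solution of the Fokker-Planck
equation `∂ₜ π = ∇ · (A π + Σ ∇π)`, `Σ = (1/2) B Bᵀ`, of the diffusion `dZ = -A(Z) dt + B dW`:
`d/dt ∫ φ dπₜ = ∫ (∑ i j, Σ i j * ∂ᵢ ∂ⱼ φ - ∇φ · A) dπₜ` for all smooth compactly supported `φ`. -/
def IsFokkerPlanckSolution {ι κ : Type*} [Fintype ι] [DecidableEq ι] [Fintype κ]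
    (A : EuclideanSpace ℝ ι → EuclideanSpace ℝ ι) (B : Matrix ι κ ℝ)
    (π : ℝ → Measure (EuclideanSpace ℝ ι)) : Prop :=
  (∀ t : ℝ, 0 ≤ t → IsProbabilityMeasure (π t)) ∧
  ∀ φ : EuclideanSpace ℝ ι → ℝ, ContDiff ℝ ∞ φ → HasCompactSupport φ →
    ∀ t : ℝ, 0 ≤ t →
      HasDerivWithinAt (fun s => ∫ z, φ z ∂(π s)) (∫ z, diffusionGenerator A B φ z ∂(π t))
        (Ici 0) t

/-- `π` is a stationary solution of the diffusion `dZ = -A(Z) dt + B dW`: the constant family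
`πₜ = π` solves the Fokker-Planck equation. -/
def IsStationarySolution {ι κ : Type*} [Fintype ι] [DecidableEq ι] [Fintype κ]
    (A : EuclideanSpace ℝ ι → EuclideanSpace ℝ ι) (B : Matrix ι κ ℝ)
    (π : Measure (EuclideanSpace ℝ ι)) : Prop :=
  IsFokkerPlanckSolution A B (fun _ : ℝ => π)

/-- The dualized potential `f(y) = y² / (2 c_f)`. -/
noncomputable def gaussF (cf : ℝ) (y : ℝ) : ℝ := 1 / (2 * cf) * y ^ 2

/-- The primal potential `g(x) = x² / (2 c_g)`. -/
noncomputable def gaussG (cg : ℝ) (x : ℝ) : ℝ := 1 / (2 * cg) * x ^ 2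

/-- The potential `h(x) = f(k x) + g(x)`. -/
noncomputable def gaussH (cf cg k : ℝ) (x : ℝ) : ℝ := gaussF cf (k * x) + gaussG cg x

/-- The target `μ*` with Lebesgue density `exp(-h(x)) / ∫ exp(-h)`. -/
noncomputable def gaussTarget (cf cg k : ℝ) : Measure ℝ :=
  (volume : Measure ℝ).tilted (fun x => - gaussH cf cg k x)

/-- The matrix of the primal-dual drift in the one-dimensional Gaussian setting. -/
noncomputable def pdMatrix (lam cf cg k : ℝ) : Matrix (Fin 2) (Fin 2) ℝ :=
  !![cg⁻¹, k; -lam * k, lam * cf]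

/-- The linear map `z ↦ A_PD z` on `ℝ²`; the drift of the diffusion is `-A_PD z`. -/
noncomputable def pdDrift (lam cf cg k : ℝ) (z : EuclideanSpace ℝ (Fin 2)) :
    EuclideanSpace ℝ (Fin 2) :=
  WithLp.toLp 2 (pdMatrix lam cf cg k *ᵥ z.ofLp)

/-- The `x`-marginal of a measure on `ℝ² ∋ (x, y)`. -/
noncomputable def xMarginal (π : Measure (EuclideanSpace ℝ (Fin 2))) : Measure ℝ :=
  π.map (fun z => z 0)

/-! The drift is linear and stable, so the diffusion is an Ornstein-Uhlenbeck process. Its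
stationary law should be the centred Gaussian whose covariance $S$ solves the Lyapunov equation
$AS+SA^T=BB^T$. As $B$ may be degenerate, that law need not have a density, so existence uses the
image of a standard Gaussian vector and uniqueness uses characteristic functions.

Existence: a factor $M$ with $MM^T=S$ is explicit in dimension two (`exists_lyapunov_sqrt`), and
Gaussian integration by parts shows that the law of $M\xi$ is stationary
(`isStationarySolution_gaussianImage`).

Uniqueness: stationarity is only given against compactly supported test functions. The quadratic
$V=\lambda x^2+y^2$ is a Lyapunov function, since the skew coupling terms cancel in it. Cutoffs
along its level sets show that every stationary law integrates $V$, and then that $\int L g\,d\pi=0$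
for suitable bounded $g$, in particular for $\cos\langle z,\xi\rangle$ and $\sin\langle
z,\xi\rangle$. This is a first-order linear equation for the characteristic function. Along the flow
$\dot x=-A^Tx$, which tends to $0$, it makes $\hat\pi(x)\exp(x^TSx/2)$ constant, hence equal to $1$
(`charFun_of_isStationarySolution`).

Impossibility: the target fixes $S_{00}=(k^2/c_f+c_g^{-1})^{-1}$. Eliminating the other entries of
$S$ gives one scalar relation between $D=BB^T$ and the parameters
(`noise_relation_of_xMarginal_eq_gaussTarget`). With $c_f=\lambda^{-1}$, varying $c_g$ forces
$D_{00}=2$; adding the relations for $k=\pm1$ then gives $D_{11}=-2\lambda<0$, although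
$D_{11}\ge0$. -/

/-- The `i`-th partial derivative of a function on `ℝ^ι`. -/
noncomputable def partialDeriv {ι : Type*} [Fintype ι] [DecidableEq ι] (i : ι)
    (φ : EuclideanSpace ℝ ι → ℝ) (z : EuclideanSpace ℝ ι) : ℝ :=
  fderiv ℝ φ z (EuclideanSpace.single i 1)

/-! ### Partial derivatives and the generator: product rule, chain rule, supports. -/

section Calculus

variable {ι κ : Type*} [Fintype ι] [DecidableEq ι] [Fintype κ]

theorem fderiv_apply_eq_sum_partialDeriv (φ : EuclideanSpace ℝ ι → ℝ) (z v : EuclideanSpace ℝ ι) :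
    fderiv ℝ φ z v = ∑ i, v i * partialDeriv i φ z := by
  have hv : v = ∑ i, v i • EuclideanSpace.single i (1 : ℝ) := by
    ext j
    simp [Finset.sum_apply, Pi.single_apply]
  conv_lhs => rw [hv]
  simp [partialDeriv]

theorem diffusionGenerator_eq (A : EuclideanSpace ℝ ι → EuclideanSpace ℝ ι) (B : Matrix ι κ ℝ)
    (φ : EuclideanSpace ℝ ι → ℝ) (z : EuclideanSpace ℝ ι) :
    diffusionGenerator A B φ z =
      (∑ i, ∑ j, ((1 / 2 : ℝ) • (B * Bᵀ)) i j * partialDeriv i (partialDeriv j φ) z)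
        - ∑ i, A z i * partialDeriv i φ z := by
  rw [← fderiv_apply_eq_sum_partialDeriv]
  rfl

theorem ContDiff.partialDeriv {φ : EuclideanSpace ℝ ι → ℝ} (hφ : ContDiff ℝ ∞ φ) (i : ι) :
    ContDiff ℝ ∞ (partialDeriv i φ) :=
  (hφ.fderiv_right (m := ∞) (by simp)).clm_apply contDiff_const

theorem HasCompactSupport.partialDeriv {φ : EuclideanSpace ℝ ι → ℝ} (hφ : HasCompactSupport φ)
    (i : ι) : HasCompactSupport (partialDeriv i φ) :=
  hφ.fderiv_apply (𝕜 := ℝ) _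

theorem partialDeriv_mul {f g : EuclideanSpace ℝ ι → ℝ} (hf : ContDiff ℝ ∞ f)
    (hg : ContDiff ℝ ∞ g) (i : ι) :
    partialDeriv i (fun z => f z * g z) =
      fun z => f z * partialDeriv i g z + g z * partialDeriv i f z := by
  ext z
  simp only [partialDeriv]
  rw [fderiv_fun_mul (hf.differentiable (by simp) z) (hg.differentiable (by simp) z)]
  simp

theorem partialDeriv_add {f g : EuclideanSpace ℝ ι → ℝ} (hf : ContDiff ℝ ∞ f)
    (hg : ContDiff ℝ ∞ g) (i : ι) :
    partialDeriv i (fun z => f z + g z) =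
      fun z => partialDeriv i f z + partialDeriv i g z := by
  ext z
  simp only [partialDeriv]
  rw [fderiv_fun_add (hf.differentiable (by simp) z) (hg.differentiable (by simp) z)]
  simp

theorem partialDeriv_comp {θ : ℝ → ℝ} {V : EuclideanSpace ℝ ι → ℝ} (hθ : ContDiff ℝ ∞ θ)
    (hV : ContDiff ℝ ∞ V) (i : ι) :
    partialDeriv i (fun z => θ (V z)) = fun z => deriv θ (V z) * partialDeriv i V z := by
  ext z
  simp only [partialDeriv]
  have h := ((hθ.differentiable (by simp) (V z)).hasDerivAt.comp_hasFDerivAt z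
    (hV.differentiable (by simp) z).hasFDerivAt).fderiv
  rw [show (fun z => θ (V z)) = θ ∘ V from rfl, h]
  simp

theorem contDiff_deriv_of_contDiff {θ : ℝ → ℝ} (hθ : ContDiff ℝ ∞ θ) : ContDiff ℝ ∞ (deriv θ) :=
  (contDiff_infty_iff_deriv.1 hθ).2

theorem diffusionGenerator_mul (A : EuclideanSpace ℝ ι → EuclideanSpace ℝ ι) (B : Matrix ι κ ℝ)
    {f g : EuclideanSpace ℝ ι → ℝ} (hf : ContDiff ℝ ∞ f) (hg : ContDiff ℝ ∞ g)
    (z : EuclideanSpace ℝ ι) :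
    diffusionGenerator A B (fun z => f z * g z) z =
      f z * diffusionGenerator A B g z + g z * diffusionGenerator A B f z +
        ∑ i, ∑ j, ((1 / 2 : ℝ) • (B * Bᵀ)) i j *
          (partialDeriv i f z * partialDeriv j g z + partialDeriv i g z * partialDeriv j f z) := by
  have h2 : ∀ i j, partialDeriv i (partialDeriv j (fun z => f z * g z)) z =
      f z * partialDeriv i (partialDeriv j g) z + g z * partialDeriv i (partialDeriv j f) z +
        (partialDeriv i f z * partialDeriv j g z + partialDeriv i g z * partialDeriv j f z) := by
    intro i j
    rw [partialDeriv_mul hf hg, partialDeriv_add (hf.mul (hg.partialDeriv j))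
      (hg.mul (hf.partialDeriv j)), partialDeriv_mul hf (hg.partialDeriv j),
      partialDeriv_mul hg (hf.partialDeriv j)]
    ring
  have h1 : ∀ i, partialDeriv i (fun z => f z * g z) z =
      f z * partialDeriv i g z + g z * partialDeriv i f z := fun i => by
    rw [partialDeriv_mul hf hg]
  simp only [diffusionGenerator_eq, h1, h2, mul_add, mul_sub, Finset.sum_add_distrib,
    Finset.mul_sum]
  simp only [mul_left_comm (f z), mul_left_comm (g z)]
  ring

theorem diffusionGenerator_comp (A : EuclideanSpace ℝ ι → EuclideanSpace ℝ ι) (B : Matrix ι κ ℝ)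
    {θ : ℝ → ℝ} {V : EuclideanSpace ℝ ι → ℝ} (hθ : ContDiff ℝ ∞ θ) (hV : ContDiff ℝ ∞ V)
    (z : EuclideanSpace ℝ ι) :
    diffusionGenerator A B (fun z => θ (V z)) z =
      deriv θ (V z) * diffusionGenerator A B V z +
        deriv (deriv θ) (V z) * ∑ i, ∑ j, ((1 / 2 : ℝ) • (B * Bᵀ)) i j *
          (partialDeriv i V z * partialDeriv j V z) := by
  have hθ' := contDiff_deriv_of_contDiff hθ
  have h2 : ∀ i j, partialDeriv i (partialDeriv j (fun z => θ (V z))) z =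
      deriv θ (V z) * partialDeriv i (partialDeriv j V) z +
        deriv (deriv θ) (V z) * (partialDeriv i V z * partialDeriv j V z) := by
    intro i j
    rw [partialDeriv_comp hθ hV, partialDeriv_mul (f := fun z => deriv θ (V z)) (hθ'.comp hV)
      (hV.partialDeriv j),
      partialDeriv_comp hθ' hV]
    ring
  have h1 : ∀ i, partialDeriv i (fun z => θ (V z)) z = deriv θ (V z) * partialDeriv i V z :=
    fun i => by rw [partialDeriv_comp hθ hV]
  simp only [diffusionGenerator_eq, h1, h2, mul_add, mul_sub, Finset.sum_add_distrib,
    Finset.mul_sum]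
  simp only [mul_left_comm (deriv θ (V z)), mul_left_comm (deriv (deriv θ) (V z))]
  ring

theorem partialDeriv_symm {φ : EuclideanSpace ℝ ι → ℝ} (hφ : ContDiff ℝ ∞ φ) (i j : ι)
    (z : EuclideanSpace ℝ ι) :
    partialDeriv i (partialDeriv j φ) z = partialDeriv j (partialDeriv i φ) z := by
  have hd : DifferentiableAt ℝ (fderiv ℝ φ) z :=
    (hφ.fderiv_right (m := ∞) (by simp)).differentiable (by simp) z
  have h : ∀ i j, partialDeriv i (partialDeriv j φ) z =
      fderiv ℝ (fderiv ℝ φ) z (EuclideanSpace.single i 1) (EuclideanSpace.single j 1) := by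
    intro i j
    change fderiv ℝ (fun w => fderiv ℝ φ w (EuclideanSpace.single j 1)) z _ = _
    rw [fderiv_clm_apply hd (differentiableAt_const _)]
    simp
  rw [h, h]
  exact (hφ.contDiffAt.isSymmSndFDerivAt (by simpa using ENat.LEInfty.out)) _ _

theorem Continuous.diffusionGenerator {A : EuclideanSpace ℝ ι → EuclideanSpace ℝ ι}
    (hA : Continuous A) (B : Matrix ι κ ℝ) {φ : EuclideanSpace ℝ ι → ℝ} (hφ : ContDiff ℝ ∞ φ) :
    Continuous (diffusionGenerator A B φ) := by
  have h1 := fun i => (hφ.partialDeriv i).continuous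
  have h2 := fun i j => ((hφ.partialDeriv j).partialDeriv i).continuous
  simp only [funext (diffusionGenerator_eq A B φ)]
  fun_prop

theorem HasCompactSupport.diffusionGenerator (A : EuclideanSpace ℝ ι → EuclideanSpace ℝ ι)
    (B : Matrix ι κ ℝ) {φ : EuclideanSpace ℝ ι → ℝ} (hφ : HasCompactSupport φ) :
    HasCompactSupport (diffusionGenerator A B φ) := by
  refine HasCompactSupport.intro hφ fun z hz => ?_
  have h1 : ∀ i, z ∉ tsupport (_root_.partialDeriv i φ) := fun i h =>
    hz (tsupport_fderiv_apply_subset ℝ _ h)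
  have h2 : ∀ i j, z ∉ tsupport (_root_.partialDeriv i (_root_.partialDeriv j φ)) := fun i j h =>
    h1 j (tsupport_fderiv_apply_subset ℝ _ h)
  rw [diffusionGenerator_eq]
  simp [fun i => image_eq_zero_of_notMem_tsupport (h1 i),
    fun i j => image_eq_zero_of_notMem_tsupport (h2 i j)]

/-- For a constant family the time derivative is zero, and one-sided derivatives within `Ici 0` are
unique, so the evolution equation reduces to a static identity. -/
theorem isStationarySolution_iff (A : EuclideanSpace ℝ ι → EuclideanSpace ℝ ι) (B : Matrix ι κ ℝ)
    (π : Measure (EuclideanSpace ℝ ι)) :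
    IsStationarySolution A B π ↔ IsProbabilityMeasure π ∧
      ∀ φ : EuclideanSpace ℝ ι → ℝ, ContDiff ℝ ∞ φ → HasCompactSupport φ →
        ∫ z, diffusionGenerator A B φ z ∂π = 0 := by
  constructor
  · rintro ⟨h1, h2⟩
    refine ⟨h1 0 le_rfl, fun φ hφ hc => ?_⟩
    exact (uniqueDiffOn_Ici (0 : ℝ) 0 self_mem_Ici).eq_deriv _ (h2 φ hφ hc 0 le_rfl)
      (hasDerivWithinAt_const _ _ _)
  · rintro ⟨h1, h2⟩
    refine ⟨fun _ _ => h1, fun φ hφ hc t _ => ?_⟩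
    rw [h2 φ hφ hc]
    exact hasDerivWithinAt_const _ _ _

end Calculus

/-! ### Gaussian integration by parts. -/

section Stein

open ProbabilityTheory

theorem hasDerivAt_gaussianPDFReal_zero_one (x : ℝ) :
    HasDerivAt (gaussianPDFReal 0 1) (-x * gaussianPDFReal 0 1 x) x := by
  have e : gaussianPDFReal 0 1 = fun y : ℝ => (√(2 * Real.pi))⁻¹ * Real.exp (-(y ^ 2 / 2)) := by
    ext y
    simp [gaussianPDFReal, neg_div]
  have h : HasDerivAt (fun y : ℝ => -(y ^ 2 / 2)) (-x) x :=
    ((hasDerivAt_pow 2 x).div_const 2).neg.congr_deriv (by simp)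
  rw [e]
  exact (h.exp.const_mul _).congr_deriv (by ring)

theorem integrable_gaussianReal_iff {f : ℝ → ℝ} :
    Integrable f (gaussianReal 0 1) ↔ Integrable (fun x => gaussianPDFReal 0 1 x * f x) := by
  rw [gaussianReal_of_var_ne_zero _ one_ne_zero,
    integrable_withDensity_iff_integrable_smul' (measurable_gaussianPDF _ _)
      (ae_of_all _ fun _ => gaussianPDF_lt_top)]
  simp

/-- The density satisfies $\rho'=-x\rho$, so $\rho\,(f'-xf)=(\rho f)'$ has integral zero. -/
theorem integral_id_mul_gaussianReal {f f' : ℝ → ℝ} {C : ℝ} (hf : ∀ x, HasDerivAt f (f' x) x)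
    (hf' : Continuous f') (hC : ∀ x, |f x| ≤ C) (hC' : ∀ x, |f' x| ≤ C) :
    ∫ x, x * f x ∂(gaussianReal 0 1) = ∫ x, f' x ∂(gaussianReal 0 1) := by
  have hfc : Continuous f := continuous_iff_continuousAt.2 fun x => (hf x).continuousAt
  have hid : Integrable (fun x : ℝ => x) (gaussianReal 0 1) :=
    (memLp_id_gaussianReal 1).integrable le_rfl
  have h1 : Integrable (fun x => x * f x) (gaussianReal 0 1) :=
    hid.mul_bdd hfc.aestronglyMeasurable (ae_of_all _ hC)
  have h2 : Integrable f' (gaussianReal 0 1) :=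
    Integrable.of_bound hf'.aestronglyMeasurable C (ae_of_all _ hC')
  have h3 : Integrable f (gaussianReal 0 1) :=
    Integrable.of_bound hfc.aestronglyMeasurable C (ae_of_all _ hC)
  have hz := integral_eq_zero_of_hasDerivAt_of_integrable
    (f := fun x => gaussianPDFReal 0 1 x * f x)
    (f' := fun x => gaussianPDFReal 0 1 x * (f' x - x * f x))
    (fun x => ((hasDerivAt_gaussianPDFReal_zero_one x).fun_mul (hf x)).congr_deriv (by ring))
    (integrable_gaussianReal_iff.1 (h2.sub h1)) (integrable_gaussianReal_iff.1 h3)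
  have hz' : ∫ x, (f' x - x * f x) ∂(gaussianReal 0 1) = 0 := by
    rw [integral_gaussianReal_eq_integral_smul one_ne_zero]
    simpa using hz
  rw [integral_sub h2 h1] at hz'
  linarith

theorem integral_eval_mul_pi_gaussianReal {n : ℕ} (i : Fin (n + 1))
    {ψ ψ' : (Fin (n + 1) → ℝ) → ℝ} {C : ℝ} (hψc : Continuous ψ) (hψ'c : Continuous ψ')
    (hψ : ∀ x, HasDerivAt (fun t : ℝ => ψ (x + t • Pi.single i (1 : ℝ))) (ψ' x) 0)
    (hC : ∀ x, |ψ x| ≤ C) (hC' : ∀ x, |ψ' x| ≤ C) :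
    Integrable (fun x => x i * ψ x) (Measure.pi fun _ => gaussianReal 0 1) ∧
    ∫ x, x i * ψ x ∂(Measure.pi fun _ => gaussianReal 0 1) =
      ∫ x, ψ' x ∂(Measure.pi fun _ => gaussianReal 0 1) := by
  have hid : Integrable (fun x : ℝ => x) (gaussianReal 0 1) :=
    (memLp_id_gaussianReal 1).integrable le_rfl
  have hI : Integrable (fun x : Fin (n + 1) → ℝ => x i * ψ x)
      (Measure.pi fun _ => gaussianReal 0 1) := by
    refine Integrable.mul_bdd (c := C) ?_ hψc.aestronglyMeasurable (ae_of_all _ hC)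
    exact (measurePreserving_eval (fun _ : Fin (n + 1) => gaussianReal 0 1)
      i).integrable_comp_of_integrable hid
  have hI' : Integrable ψ' (Measure.pi fun _ => gaussianReal 0 1) :=
    Integrable.of_bound hψ'c.aestronglyMeasurable C (ae_of_all _ hC')
  refine ⟨hI, ?_⟩
  -- Fubini with the `i`-th coordinate as inner variable reduces to the one-dimensional identity on
  -- each line.
  have mp := (measurePreserving_piFinSuccAbove (fun _ : Fin (n + 1) => gaussianReal 0 1) i).symm
  rw [← mp.integral_comp', ← mp.integral_comp', integral_prod_symm, integral_prod_symm]
  rotate_left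
  · exact (mp.integrable_comp_emb (MeasurableEquiv.measurableEmbedding _)).2 hI'
  · exact (mp.integrable_comp_emb (MeasurableEquiv.measurableEmbedding _)).2 hI
  congr 1
  ext y
  have e : ∀ t, (MeasurableEquiv.piFinSuccAbove (fun _ => ℝ) i).symm (t, y) =
      (i.insertNth t y : Fin (n + 1) → ℝ) := fun t => rfl
  simp only [e, Fin.insertNth_apply_same]
  refine integral_id_mul_gaussianReal (C := C) (fun t => ?_) ?_ (fun _ => hC _) (fun _ => hC' _)
  · have h := hψ (i.insertNth t y)
    have h0 : HasDerivAt (fun s : ℝ => s - t) 1 t := (hasDerivAt_id t).sub_const t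
    have h1 := HasDerivAt.comp (h₂ := fun s : ℝ => ψ (i.insertNth t y + s • Pi.single i (1 : ℝ)))
      (h₂' := ψ' (i.insertNth t y)) t (by simpa using h) h0
    refine (h1.congr_of_eventuallyEq (Filter.Eventually.of_forall fun s => ?_)).congr_deriv
      (mul_one _)
    simp only [Function.comp]
    congr 1
    ext j
    refine Fin.succAboveCases i ?_ (fun k => ?_) j <;> simp
  · fun_prop

end Stein

/-- The law of `M ξ` for a standard Gaussian vector `ξ`. -/
noncomputable def gaussianImage {ι : Type*} [Fintype ι] {n : ℕ} (M : Matrix ι (Fin n) ℝ) :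
    Measure (EuclideanSpace ℝ ι) :=
  (Measure.pi fun _ : Fin n => ProbabilityTheory.gaussianReal 0 1).map
    (fun x => WithLp.toLp 2 (M *ᵥ x))

/-! ### Gaussian stationary laws and the Lyapunov equation. -/

section GaussianStationary

variable {ι κ : Type*} [Fintype ι] [DecidableEq ι] [Fintype κ]

/-- Moving $x$ along the `l`-th basis vector moves $Mx$ along the `l`-th column of $M$; this
supplies the derivative in the integration by parts. -/
theorem integral_eval_mul_partialDeriv_comp {n : ℕ} (M : Matrix ι (Fin (n + 1)) ℝ)
    {ψ : EuclideanSpace ℝ ι → ℝ} (hψ : ContDiff ℝ ∞ ψ) (hc : HasCompactSupport ψ)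
    (l : Fin (n + 1)) :
    Integrable (fun x => x l * ψ (WithLp.toLp 2 (M *ᵥ x)))
      (Measure.pi fun _ => ProbabilityTheory.gaussianReal 0 1) ∧
    ∫ x, x l * ψ (WithLp.toLp 2 (M *ᵥ x))
        ∂(Measure.pi fun _ => ProbabilityTheory.gaussianReal 0 1) =
      ∑ j, M j l * ∫ x, partialDeriv j ψ (WithLp.toLp 2 (M *ᵥ x))
        ∂(Measure.pi fun _ => ProbabilityTheory.gaussianReal 0 1) := by
  have hM : Continuous fun x : Fin (n + 1) → ℝ => WithLp.toLp 2 (M *ᵥ x) := by fun_prop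
  have hpc : ∀ j, Continuous (partialDeriv j ψ) := fun j => (hψ.partialDeriv j).continuous
  obtain ⟨C₀, hC₀⟩ := hc.exists_bound_of_continuous hψ.continuous
  have hsum : HasCompactSupport fun z => ∑ j, M j l * partialDeriv j ψ z := by
    have := hc.fderiv_apply (𝕜 := ℝ) (WithLp.toLp 2 fun j => M j l)
    simpa only [fderiv_apply_eq_sum_partialDeriv] using this
  obtain ⟨C₁, hC₁⟩ := hsum.exists_bound_of_continuous (by fun_prop)
  have key := integral_eval_mul_pi_gaussianReal (C := max C₀ C₁) l
    (ψ := fun x => ψ (WithLp.toLp 2 (M *ᵥ x)))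
    (ψ' := fun x => ∑ j, M j l * partialDeriv j ψ (WithLp.toLp 2 (M *ᵥ x)))
    (hψ.continuous.comp hM) (by have := fun j => (hpc j).comp hM; fun_prop) (fun x => ?_)
    (fun x => (hC₀ _).trans (le_max_left _ _)) (fun x => (hC₁ _).trans (le_max_right _ _))
  · refine ⟨key.1, key.2.trans ?_⟩
    rw [integral_finsetSum]
    · simp only [integral_const_mul]
    · intro j _
      obtain ⟨C, hC⟩ := (hc.partialDeriv j).exists_bound_of_continuous (hpc j)
      exact (Integrable.of_bound ((hpc j).comp hM).aestronglyMeasurable C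
        (ae_of_all _ fun x => hC _)).const_mul _
  · have h1 : HasDerivAt (fun t : ℝ => (WithLp.toLp 2 (M *ᵥ x) : EuclideanSpace ℝ ι) +
        t • WithLp.toLp 2 fun j => M j l) (WithLp.toLp 2 fun j => M j l) 0 := by
      simpa using ((hasDerivAt_id (0 : ℝ)).smul_const
        (WithLp.toLp 2 fun j => M j l : EuclideanSpace ℝ ι)).const_add
          (WithLp.toLp 2 (M *ᵥ x) : EuclideanSpace ℝ ι)
    have h2 := (hψ.differentiable (by simp)
      (WithLp.toLp 2 (M *ᵥ x) + (0 : ℝ) • WithLp.toLp 2 fun j => M j l)).hasFDerivAt.comp_hasDerivAt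
        (0 : ℝ) h1
    rw [zero_smul, add_zero, fderiv_apply_eq_sum_partialDeriv] at h2
    refine h2.congr_of_eventuallyEq (Filter.Eventually.of_forall fun t => ?_)
    simp only [Function.comp]
    congr 1
    ext j
    simp [Matrix.mulVec_add, Matrix.mulVec_smul]

/-- Integration by parts turns the drift term into $\sum_{ij}(AMM^T)_{ij}H_{ij}$, where $H$ is the
averaged Hessian. As $H$ is symmetric, only the symmetric part of $AMM^T$ matters, and by `h` this
is $\frac12BB^T$, which cancels the diffusion term. -/
theorem isStationarySolution_gaussianImage {n : ℕ} (A : Matrix ι ι ℝ) (B : Matrix ι κ ℝ)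
    (M : Matrix ι (Fin (n + 1)) ℝ) (h : A * (M * Mᵀ) + M * Mᵀ * Aᵀ = B * Bᵀ) :
    IsStationarySolution (fun z : EuclideanSpace ℝ ι => WithLp.toLp 2 (A *ᵥ z.ofLp)) B
      (gaussianImage M) := by
  have hM : Continuous fun x : Fin (n + 1) → ℝ =>
    (WithLp.toLp 2 (M *ᵥ x) : EuclideanSpace ℝ ι) := by fun_prop
  rw [isStationarySolution_iff]
  refine ⟨Measure.isProbabilityMeasure_map hM.aemeasurable, fun φ hφ hc => ?_⟩
  rw [gaussianImage, integral_map hM.aemeasurable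
    (Continuous.diffusionGenerator (by fun_prop) B hφ).aestronglyMeasurable]
  simp only [diffusionGenerator_eq]
  set γ : Measure (Fin (n + 1) → ℝ) := Measure.pi fun _ => ProbabilityTheory.gaussianReal 0 1
  set H : ι → ι → ℝ := fun i j =>
    ∫ x, partialDeriv i (partialDeriv j φ) (WithLp.toLp 2 (M *ᵥ x)) ∂γ with hH
  have hHsymm : ∀ i j, H i j = H j i := fun i j => by
    simp only [hH, partialDeriv_symm hφ i j]
  have hint : ∀ i j, Integrable
      (fun x => partialDeriv i (partialDeriv j φ) (WithLp.toLp 2 (M *ᵥ x))) γ := fun i j => by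
    have hcont := ((hφ.partialDeriv j).partialDeriv i).continuous
    obtain ⟨C, hC⟩ := ((hc.partialDeriv j).partialDeriv i).exists_bound_of_continuous hcont
    exact Integrable.of_bound (hcont.comp hM).aestronglyMeasurable C (ae_of_all _ fun x => hC _)
  have hst := fun i l => integral_eval_mul_partialDeriv_comp M (hφ.partialDeriv i)
    (hc.partialDeriv i) l
  have hdrift : ∀ x : Fin (n + 1) → ℝ, ∑ i, (A *ᵥ (M *ᵥ x)) i *
      partialDeriv i φ (WithLp.toLp 2 (M *ᵥ x)) =
      ∑ i, ∑ l, (A * M) i l * (x l * partialDeriv i φ (WithLp.toLp 2 (M *ᵥ x))) := fun x => by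
    refine Finset.sum_congr rfl fun i _ => ?_
    rw [Matrix.mulVec_mulVec, Matrix.mulVec, dotProduct, Finset.sum_mul]
    exact Finset.sum_congr rfl fun l _ => mul_assoc _ _ _
  simp only [hdrift]
  have hi1 : ∀ i, Integrable (fun x => ∑ l, (A * M) i l *
      (x l * partialDeriv i φ (WithLp.toLp 2 (M *ᵥ x)))) γ := fun i =>
    integrable_finsetSum _ fun l _ => (hst i l).1.const_mul _
  have hi2 : ∀ i, Integrable (fun x => ∑ j, ((1 / 2 : ℝ) • (B * Bᵀ)) i j *
      partialDeriv i (partialDeriv j φ) (WithLp.toLp 2 (M *ᵥ x))) γ := fun i =>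
    integrable_finsetSum _ fun j _ => (hint i j).const_mul _
  rw [integral_sub (integrable_finsetSum _ fun i _ => hi2 i)
    (integrable_finsetSum _ fun i _ => hi1 i),
    integral_finsetSum _ fun i _ => hi2 i, integral_finsetSum _ fun i _ => hi1 i]
  have e2 : ∀ i, ∫ x, ∑ j, ((1 / 2 : ℝ) • (B * Bᵀ)) i j *
      partialDeriv i (partialDeriv j φ) (WithLp.toLp 2 (M *ᵥ x)) ∂γ =
      ∑ j, 1 / 2 * ((A * (M * Mᵀ)) i j + (A * (M * Mᵀ)) j i) * H i j := fun i => by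
    rw [integral_finsetSum _ fun j _ => (hint i j).const_mul _]
    refine Finset.sum_congr rfl fun j _ => ?_
    rw [integral_const_mul, ← h]
    have : M * Mᵀ * Aᵀ = (A * (M * Mᵀ))ᵀ := by simp [Matrix.transpose_mul, Matrix.mul_assoc]
    rw [this]
    simp only [Matrix.smul_apply, Matrix.add_apply, Matrix.transpose_apply, smul_eq_mul, hH]
  have e1 : ∀ i, ∫ x, ∑ l, (A * M) i l *
      (x l * partialDeriv i φ (WithLp.toLp 2 (M *ᵥ x))) ∂γ =
      ∑ j, (A * (M * Mᵀ)) i j * H i j := fun i => by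
    rw [integral_finsetSum _ fun l _ => (hst i l).1.const_mul _]
    simp only [integral_const_mul, (hst i _).2, Finset.mul_sum]
    rw [Finset.sum_comm]
    refine Finset.sum_congr rfl fun j _ => ?_
    rw [← Matrix.mul_assoc, Matrix.mul_apply, Finset.sum_mul, hHsymm i j]
    exact Finset.sum_congr rfl fun l _ => by simp only [Matrix.transpose_apply, hH]; ring
  simp only [e1, e2]
  have e3 : ∑ i, ∑ j, (A * (M * Mᵀ)) j i * H i j = ∑ i, ∑ j, (A * (M * Mᵀ)) i j * H i j := by
    rw [Finset.sum_comm]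
    exact Finset.sum_congr rfl fun i _ => Finset.sum_congr rfl fun j _ => by rw [hHsymm i j]
  simp only [mul_add, add_mul, Finset.sum_add_distrib, mul_assoc, ← Finset.mul_sum, e3]
  ring

/-- Take $M=[\,rB\mid s\,\mathrm{adj}(A)B\,]$ with $r^2=1/(2\,\mathrm{tr}A)$ and $s^2=r^2/\det A$.
Since $A\,\mathrm{adj}(A)=\det A\cdot I$ and $A+\mathrm{adj}(A)=\mathrm{tr}A\cdot I$, the left side
collapses to $2r^2\,\mathrm{tr}A\cdot BB^T=BB^T$. Giving a factor rather than $S$ makes positivity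
automatic. -/
theorem exists_lyapunov_sqrt (A B : Matrix (Fin 2) (Fin 2) ℝ) (htr : 0 < A.trace)
    (hdet : 0 < A.det) :
    ∃ M : Matrix (Fin 2) (Fin 4) ℝ, A * (M * Mᵀ) + M * Mᵀ * Aᵀ = B * Bᵀ := by
  rw [Matrix.trace_fin_two] at htr
  rw [Matrix.det_fin_two] at hdet
  obtain ⟨a, ha⟩ : ∃ a, a = A 0 0 := ⟨_, rfl⟩
  obtain ⟨b, hb⟩ : ∃ b, b = A 0 1 := ⟨_, rfl⟩
  obtain ⟨c, hc⟩ : ∃ c, c = A 1 0 := ⟨_, rfl⟩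
  obtain ⟨d, hd⟩ : ∃ d, d = A 1 1 := ⟨_, rfl⟩
  obtain ⟨e, he⟩ : ∃ e, e = B 0 0 := ⟨_, rfl⟩
  obtain ⟨f, hf⟩ : ∃ f, f = B 0 1 := ⟨_, rfl⟩
  obtain ⟨g, hg⟩ : ∃ g, g = B 1 0 := ⟨_, rfl⟩
  obtain ⟨k, hk⟩ : ∃ k, k = B 1 1 := ⟨_, rfl⟩
  have hA : A = !![a, b; c, d] := by
    rw [ha, hb, hc, hd]
    exact Matrix.eta_fin_two A
  have hB : B = !![e, f; g, k] := by
    rw [he, hf, hg, hk]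
    exact Matrix.eta_fin_two B
  rw [← ha, ← hd] at htr
  rw [← ha, ← hb, ← hc, ← hd] at hdet
  obtain ⟨r, hr⟩ : ∃ r : ℝ, r ^ 2 = (2 * (a + d))⁻¹ := ⟨_, Real.sq_sqrt (by positivity)⟩
  obtain ⟨s, hs⟩ : ∃ s : ℝ, s ^ 2 = (2 * (a + d) * (a * d - b * c))⁻¹ :=
    ⟨_, Real.sq_sqrt (by positivity)⟩
  have h1 : 2 * (a + d) * r ^ 2 = 1 := by
    rw [hr]
    field_simp
  have h2 : r ^ 2 = s ^ 2 * (a * d - b * c) := by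
    rw [hr, hs]
    field_simp
  refine ⟨!![r * e, r * f, s * (d * e - b * g), s * (d * f - b * k);
    r * g, r * k, s * (a * g - c * e), s * (a * k - c * f)], ?_⟩
  subst hA hB
  ext i j
  simp only [Matrix.add_apply, Matrix.mul_apply, Matrix.transpose_apply, Fin.sum_univ_four,
    Fin.sum_univ_two]
  fin_cases i <;> fin_cases j <;> simp
  · linear_combination (e ^ 2 + f ^ 2) * h1 -
      2 * (d * (e ^ 2 + f ^ 2) - b * (e * g + f * k)) * h2
  · linear_combination (e * g + f * k) * h1 -
      (d * (e * g + f * k) - b * (g ^ 2 + k ^ 2) - c * (e ^ 2 + f ^ 2) + a * (e * g + f * k)) * h2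
  · linear_combination (e * g + f * k) * h1 -
      (d * (e * g + f * k) - b * (g ^ 2 + k ^ 2) - c * (e ^ 2 + f ^ 2) + a * (e * g + f * k)) * h2
  · linear_combination (g ^ 2 + k ^ 2) * h1 -
      2 * (a * (g ^ 2 + k ^ 2) - c * (e * g + f * k)) * h2

end GaussianStationary

/-! ### A smooth decreasing cutoff. -/

section Cutoff

open Filter Topology

/-- The slope bound $-c$ on $[0,1]$ is what later extracts a moment from the cutoff. Bounds are
needed only for $s\ge0$, the range of the Lyapunov function. -/
theorem exists_smooth_antitone_cutoff : ∃ (η : ℝ → ℝ) (K c : ℝ), ContDiff ℝ ∞ η ∧ 0 < c ∧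
    0 < η 0 ∧ (∀ s, 2 < s → η s = 0 ∧ deriv η s = 0 ∧ deriv (deriv η) s = 0) ∧
    (∀ s, 0 ≤ s → |η s| ≤ K ∧ |deriv η s| ≤ K ∧ |deriv (deriv η) s| ≤ K) ∧
    (∀ s, deriv η s ≤ 0) ∧ (∀ s, s ≤ 1 → 0 ≤ s → deriv η s ≤ -c) := by
  have hη : ContDiff ℝ ∞ (fun s : ℝ => expNegInvGlue (2 - s)) :=
    expNegInvGlue.contDiff.comp (contDiff_const.sub contDiff_id)
  set η : ℝ → ℝ := fun s => expNegInvGlue (2 - s) with hdef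
  have hη' := contDiff_deriv_of_contDiff hη
  have hη'' := contDiff_deriv_of_contDiff hη'
  have hzero : ∀ s, 2 < s → η =ᶠ[𝓝 s] fun _ => 0 := fun s hs => by
    filter_upwards [Ioi_mem_nhds hs] with t ht
    exact expNegInvGlue.zero_of_nonpos (by linarith [mem_Ioi.1 ht])
  have hzeros : ∀ s, 2 < s → η s = 0 ∧ deriv η s = 0 ∧ deriv (deriv η) s = 0 := fun s hs => by
    have h1 := (hzero s hs).deriv
    have h2 := h1.deriv
    refine ⟨(hzero s hs).eq_of_nhds, ?_, ?_⟩
    · simpa using h1.eq_of_nhds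
    · simpa using h2.eq_of_nhds
  have hbound : ∀ f : ℝ → ℝ, Continuous f → (∀ s, 2 < s → f s = 0) →
      ∃ K, ∀ s, 0 ≤ s → |f s| ≤ K := fun f hf h0 => by
    obtain ⟨K, hK⟩ := (isCompact_Icc (a := (0 : ℝ)) (b := 2)).exists_bound_of_continuousOn
      hf.continuousOn
    refine ⟨K, fun s hs => ?_⟩
    by_cases h : s ≤ 2
    · exact hK s ⟨hs, h⟩
    · rw [h0 s (not_le.1 h), abs_zero]
      exact (norm_nonneg _).trans (hK 0 ⟨le_rfl, by norm_num⟩)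
  obtain ⟨K₀, hK₀⟩ := hbound η hη.continuous fun s hs => (hzeros s hs).1
  obtain ⟨K₁, hK₁⟩ := hbound _ hη'.continuous fun s hs => (hzeros s hs).2.1
  obtain ⟨K₂, hK₂⟩ := hbound _ hη''.continuous fun s hs => (hzeros s hs).2.2
  have hneg : ∀ s, s ≤ 1 → deriv η s < 0 := fun s hs => by
    have hpos : 0 < 2 - s := by linarith
    have h1 : HasDerivAt (fun t : ℝ => Real.exp (-(2 - t)⁻¹))
        (Real.exp (-(2 - s)⁻¹) * (-((2 - s) ^ 2)⁻¹)) s := by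
      have := (((hasDerivAt_id s).const_sub 2).inv hpos.ne').neg.exp
      exact this.congr_deriv (by simp)
    have h2 : η =ᶠ[𝓝 s] fun t : ℝ => Real.exp (-(2 - t)⁻¹) := by
      filter_upwards [Iio_mem_nhds (show s < 2 by linarith)] with t ht
      have : ¬ (2 - t ≤ 0) := by linarith [mem_Iio.1 ht]
      simp only [hdef, expNegInvGlue, if_neg this]
    rw [(h1.congr_of_eventuallyEq h2).deriv]
    have : 0 < ((2 - s) ^ 2)⁻¹ := by positivity
    nlinarith [Real.exp_pos (-(2 - s)⁻¹)]
  have hanti : Antitone η := fun s t hst => expNegInvGlue.monotone (by linarith)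
  -- The derivative is continuous and negative on $[0,1]$, so its maximum there is negative; $c$ is
  -- minus that maximum.
  obtain ⟨s₀, hs₀, hmax⟩ := (isCompact_Icc (a := (0 : ℝ)) (b := 1)).exists_isMaxOn
    ⟨0, by simp⟩ hη'.continuous.continuousOn
  refine ⟨η, max K₀ (max K₁ K₂), -deriv η s₀, hη, by linarith [hneg s₀ hs₀.2],
    expNegInvGlue.pos_of_pos (by norm_num), hzeros, fun s hs => ⟨?_, ?_, ?_⟩, fun s => ?_,
    fun s h1 h0 => ?_⟩
  · exact (hK₀ s hs).trans (le_max_left _ _)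
  · exact (hK₁ s hs).trans ((le_max_left _ _).trans (le_max_right _ _))
  · exact (hK₂ s hs).trans ((le_max_right _ _).trans (le_max_right _ _))
  · exact hanti.deriv_nonpos
  · rw [neg_neg]
    exact hmax ⟨h0, h1⟩

end Cutoff

/-! ### Lyapunov functions: moments and a larger class of test functions. -/

section Lyapunov

open Filter Topology

variable {ι κ : Type*} [Fintype ι] [DecidableEq ι] [Fintype κ]

/-- `V` is a smooth Lyapunov function of quadratic growth for the diffusion
`dZ = -A(Z) dt + B dW`. -/
structure IsQuadraticLyapunov (A : EuclideanSpace ℝ ι → EuclideanSpace ℝ ι) (B : Matrix ι κ ℝ)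
    (V : EuclideanSpace ℝ ι → ℝ) (C m : ℝ) : Prop where
  contDiff : ContDiff ℝ ∞ V
  nonneg : ∀ z, 0 ≤ V z
  norm_sq_le : ∀ z, ‖z‖ ^ 2 ≤ C * V z
  sq_partialDeriv_le : ∀ i z, partialDeriv i V z ^ 2 ≤ C * V z
  pos : 0 < m
  generator_le : ∀ z, diffusionGenerator A B V z ≤ C - m * V z
  abs_generator_le : ∀ z, |diffusionGenerator A B V z| ≤ C * (1 + V z)

/-- The carré du champ `∑ i j, Σ i j * ∂ᵢ V * ∂ⱼ V` with `Σ = (1/2) B Bᵀ`. -/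
noncomputable def carreDuChamp (B : Matrix ι κ ℝ) (V : EuclideanSpace ℝ ι → ℝ)
    (z : EuclideanSpace ℝ ι) : ℝ :=
  ∑ i, ∑ j, ((1 / 2 : ℝ) • (B * Bᵀ)) i j * (partialDeriv i V z * partialDeriv j V z)

theorem contDiff_comp_const_mul {η : ℝ → ℝ} (hη : ContDiff ℝ ∞ η) (ε : ℝ) :
    ContDiff ℝ ∞ fun s => η (ε * s) :=
  hη.comp (contDiff_const.mul contDiff_id)

theorem diffusionGenerator_comp_const_mul (A : EuclideanSpace ℝ ι → EuclideanSpace ℝ ι)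
    (B : Matrix ι κ ℝ) {η : ℝ → ℝ} {V : EuclideanSpace ℝ ι → ℝ} (hη : ContDiff ℝ ∞ η)
    (hV : ContDiff ℝ ∞ V) (ε : ℝ) (z : EuclideanSpace ℝ ι) :
    diffusionGenerator A B (fun z => η (ε * V z)) z =
      ε * (deriv η (ε * V z) * diffusionGenerator A B V z) +
        ε ^ 2 * (deriv (deriv η) (ε * V z) * carreDuChamp B V z) := by
  have h1 : ∀ f : ℝ → ℝ, deriv (fun s => f (ε * s)) = fun s => ε * deriv f (ε * s) := fun f => by
    ext s
    rw [deriv_comp_mul_left, smul_eq_mul]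
  rw [diffusionGenerator_comp (θ := fun s => η (ε * s)) A B (contDiff_comp_const_mul hη ε) hV, h1,
    deriv_const_mul_field, h1, carreDuChamp]
  ring

namespace IsQuadraticLyapunov

variable {A : EuclideanSpace ℝ ι → EuclideanSpace ℝ ι} {B : Matrix ι κ ℝ}
  {V : EuclideanSpace ℝ ι → ℝ} {C m : ℝ}

theorem abs_carreDuChamp_le (hV : IsQuadraticLyapunov A B V C m) (z : EuclideanSpace ℝ ι) :
    |carreDuChamp B V z| ≤ (∑ i, ∑ j, |((1 / 2 : ℝ) • (B * Bᵀ)) i j|) * C * V z := by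
  rw [carreDuChamp, mul_assoc, Finset.sum_mul]
  refine (Finset.abs_sum_le_sum_abs _ _).trans (Finset.sum_le_sum fun i _ => ?_)
  rw [Finset.sum_mul]
  refine (Finset.abs_sum_le_sum_abs _ _).trans (Finset.sum_le_sum fun j _ => ?_)
  rw [abs_mul]
  refine mul_le_mul_of_nonneg_left ?_ (abs_nonneg _)
  rw [abs_le]
  constructor <;> nlinarith [hV.sq_partialDeriv_le i z, hV.sq_partialDeriv_le j z,
    sq_nonneg (partialDeriv i V z + partialDeriv j V z),
    sq_nonneg (partialDeriv i V z - partialDeriv j V z)]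

theorem abs_partialDeriv_le (hV : IsQuadraticLyapunov A B V C m) (i : ι)
    (z : EuclideanSpace ℝ ι) : |partialDeriv i V z| ≤ 1 + C * V z := by
  rw [abs_le]
  constructor <;> nlinarith [hV.sq_partialDeriv_le i z, sq_nonneg (partialDeriv i V z + 1),
    sq_nonneg (partialDeriv i V z - 1)]

theorem hasCompactSupport_comp (hV : IsQuadraticLyapunov A B V C m) {η : ℝ → ℝ}
    (hη : ∀ s, 2 < s → η s = 0) {ε : ℝ} (hε : 0 < ε) (hC : 0 ≤ C) :
    HasCompactSupport fun z => η (ε * V z) := by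
  refine HasCompactSupport.intro (isCompact_closedBall (0 : EuclideanSpace ℝ ι)
    (√(C * (2 / ε)))) fun z hz => hη _ ?_
  rw [mem_closedBall_zero_iff, not_le, Real.sqrt_lt' ((Real.sqrt_nonneg _).trans_lt
    (by simpa using hz))] at hz
  have h1 := hz.trans_le (hV.norm_sq_le z)
  have h2 : 2 / ε < V z := lt_of_mul_lt_mul_left h1 hC
  rw [div_lt_iff₀ hε] at h2
  linarith

/-- Test with $\eta(\varepsilon V)$ and divide by $\varepsilon$. The term $\eta'(\varepsilon V)LV$
is at least $c\,mV-KC$ where $\varepsilon V\le1$ and at least $-KC$ elsewhere. The second-order term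
is bounded uniformly in $\varepsilon$, because the carré du champ is at most $DV$ and $\eta''$
vanishes beyond $2$. So the integrals of $V$ over its sublevel sets stay bounded. -/
theorem integrable (hV : IsQuadraticLyapunov A B V C m) (hA : Continuous A) (hC : 0 ≤ C)
    {π : Measure (EuclideanSpace ℝ ι)} (hπ : IsStationarySolution A B π) : Integrable V π := by
  rw [isStationarySolution_iff] at hπ
  obtain ⟨hprob, hπ⟩ := hπ
  obtain ⟨η, K, c, hη, hc, -, hzero, hK, hneg, hlow⟩ := exists_smooth_antitone_cutoff
  have hK0 : 0 ≤ K := (abs_nonneg _).trans (hK 0 le_rfl).1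
  set D := (∑ i, ∑ j, |((1 / 2 : ℝ) • (B * Bᵀ)) i j|) * C with hD
  have hD0 : 0 ≤ D :=
    mul_nonneg (Finset.sum_nonneg fun i _ => Finset.sum_nonneg fun j _ => abs_nonneg _) hC
  have hset : ∀ n : ℕ, MeasurableSet {z | V z ≤ n + 1} := fun n =>
    (isClosed_le hV.contDiff.continuous continuous_const).measurableSet
  have hcover : AECover π atTop fun n : ℕ => {z | V z ≤ n + 1} :=
    { ae_eventually_mem := ae_of_all _ fun z => by
        obtain ⟨N, hN⟩ := exists_nat_ge (V z)
        filter_upwards [eventually_ge_atTop N] with n hn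
        have : (N : ℝ) ≤ n := by exact_mod_cast hn
        exact hN.trans (this.trans (by linarith))
      measurableSet := hset }
  have hion : ∀ n : ℕ, IntegrableOn V {z | V z ≤ n + 1} π := fun n => by
    refine Measure.integrableOn_of_bounded (M := n + 1) (measure_ne_top _ _)
      hV.contDiff.continuous.aestronglyMeasurable ?_
    filter_upwards [ae_restrict_mem (hset n)] with z hz
    rw [Real.norm_eq_abs, abs_of_nonneg (hV.nonneg z)]
    exact hz
  refine hcover.integrable_of_integral_bounded_of_nonneg_ae ((c * m)⁻¹ * (K * C + 2 * K * D)) hion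
    (ae_of_all _ hV.nonneg) (Eventually.of_forall fun n => ?_)
  -- This scale makes $V\le n+1$ equivalent to $\varepsilon V\le1$, where the slope bound applies.
  obtain ⟨ε, hεdef⟩ : ∃ ε : ℝ, ε = ((n : ℝ) + 1)⁻¹ := ⟨_, rfl⟩
  have hε : 0 < ε := by rw [hεdef]; positivity
  have hφ : ContDiff ℝ ∞ fun z => η (ε * V z) := hη.comp (contDiff_const.mul hV.contDiff)
  have hφc := hV.hasCompactSupport_comp (fun s hs => (hzero s hs).1) hε hC
  have hint := hπ _ hφ hφc
  have hLi : Integrable (diffusionGenerator A B fun z => η (ε * V z)) π :=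
    (Continuous.diffusionGenerator hA B hφ).integrable_of_hasCompactSupport
      (HasCompactSupport.diffusionGenerator A B hφc)
  have hpt : ∀ z, {z | V z ≤ (n : ℝ) + 1}.indicator (fun z => (c * m) * V z) z ≤
      ε⁻¹ * diffusionGenerator A B (fun z => η (ε * V z)) z + (K * C + 2 * K * D) := fun z => by
    have hVz := hV.nonneg z
    have hεV : 0 ≤ ε * V z := by positivity
    obtain ⟨-, hk1, hk2⟩ := hK _ hεV
    have e : ε⁻¹ * diffusionGenerator A B (fun z => η (ε * V z)) z =
        deriv η (ε * V z) * diffusionGenerator A B V z +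
          ε * (deriv (deriv η) (ε * V z) * carreDuChamp B V z) := by
      rw [diffusionGenerator_comp_const_mul A B hη hV.contDiff]
      field_simp
    have h1 : deriv η (ε * V z) * (C - m * V z) ≤
        deriv η (ε * V z) * diffusionGenerator A B V z :=
      mul_le_mul_of_nonpos_left (hV.generator_le z) (hneg _)
    have h2 : -(K * C) ≤ deriv η (ε * V z) * C := by
      have := (abs_le.1 hk1).1
      nlinarith
    have h3 : |ε * (deriv (deriv η) (ε * V z) * carreDuChamp B V z)| ≤ 2 * K * D := by
      by_cases h : 2 < ε * V z
      · rw [(hzero _ h).2.2]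
        simp only [zero_mul, mul_zero, abs_zero]
        positivity
      · rw [abs_mul, abs_mul, abs_of_pos hε]
        calc ε * (|deriv (deriv η) (ε * V z)| * |carreDuChamp B V z|)
            ≤ ε * (K * (D * V z)) := by
              gcongr
              exact hV.abs_carreDuChamp_le z
          _ = (ε * V z) * (K * D) := by ring
          _ ≤ 2 * (K * D) := by
              gcongr
              exact not_lt.1 h
          _ = 2 * K * D := by ring
    have h4 : {z | V z ≤ (n : ℝ) + 1}.indicator (fun z => (c * m) * V z) z ≤
        -deriv η (ε * V z) * (m * V z) := by
      have hmV : 0 ≤ m * V z := mul_nonneg hV.pos.le hVz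
      by_cases h : V z ≤ (n : ℝ) + 1
      · rw [indicator_of_mem (by exact h), mul_assoc]
        refine mul_le_mul_of_nonneg_right ?_ hmV
        have : ε * V z ≤ 1 := by
          rw [hεdef, inv_mul_le_iff₀ (by positivity), mul_one]
          exact h
        linarith [hlow _ this hεV]
      · rw [indicator_of_notMem (by exact h)]
        exact mul_nonneg (neg_nonneg.2 (hneg _)) hmV
    rw [e]
    linarith [(abs_le.1 h3).1]
  have hle := integral_mono ((integrable_indicator_iff (hset n)).2 ((hion n).const_mul (c * m)))
    ((hLi.const_mul ε⁻¹).add (integrable_const (K * C + 2 * K * D))) hpt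
  have e1 : ∫ z, (ε⁻¹ * diffusionGenerator A B (fun z => η (ε * V z)) z + (K * C + 2 * K * D)) ∂π
      = K * C + 2 * K * D := by
    rw [integral_add (hLi.const_mul _) (integrable_const _), integral_const_mul, hint]
    simp
  have hle' : ∫ z in {z | V z ≤ (n : ℝ) + 1}, c * m * V z ∂π ≤ K * C + 2 * K * D := by
    rw [← integral_indicator (hset n), ← e1]
    exact hle
  rw [integral_const_mul] at hle'
  have hcm : 0 < c * m := mul_pos hc hV.pos
  rwa [← div_eq_inv_mul, le_div_iff₀' hcm]

/-- The product $\eta(\varepsilon V)g$ is an admissible test function. In its generator every term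
except $\eta(\varepsilon V)Lg$ carries a factor $\varepsilon$, and all are dominated by $|Lg|$ and
$1+V$, which are integrable. The limit is $\eta(0)\int Lg\,d\pi$, and $\eta(0)>0$. -/
theorem integral_generator_eq_zero (hV : IsQuadraticLyapunov A B V C m) (hA : Continuous A)
    (hC : 0 ≤ C) {π : Measure (EuclideanSpace ℝ ι)} (hπ : IsStationarySolution A B π)
    {g : EuclideanSpace ℝ ι → ℝ} {G : ℝ} (hg : ContDiff ℝ ∞ g) (hG : ∀ z, |g z| ≤ G)
    (hG' : ∀ i z, |partialDeriv i g z| ≤ G) (hLg : Integrable (diffusionGenerator A B g) π) :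
    ∫ z, diffusionGenerator A B g z ∂π = 0 := by
  have hVi := hV.integrable hA hC hπ
  rw [isStationarySolution_iff] at hπ
  obtain ⟨hprob, hπ⟩ := hπ
  obtain ⟨η, K, c, hη, -, hη0, hzero, hK, -, -⟩ := exists_smooth_antitone_cutoff
  have hK0 : 0 ≤ K := (abs_nonneg _).trans (hK 0 le_rfl).1
  have hG0 : 0 ≤ G := (abs_nonneg _).trans (hG 0)
  set T := ∑ i, ∑ j, |((1 / 2 : ℝ) • (B * Bᵀ)) i j| with hT
  set ε : ℕ → ℝ := fun n => ((n : ℝ) + 1)⁻¹ with hεdef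
  have hε : ∀ n, 0 < ε n := fun n => by positivity
  have hε1 : ∀ n, ε n ≤ 1 := fun n => inv_le_one_of_one_le₀ (by simp)
  have hεlim : Tendsto ε atTop (𝓝 0) := by
    simpa [hεdef] using tendsto_one_div_add_atTop_nhds_zero_nat (𝕜 := ℝ)
  have hf : ∀ t : ℝ, ContDiff ℝ ∞ fun z => η (t * V z) :=
    fun t => hη.comp (contDiff_const.mul hV.contDiff)
  have hpf : ∀ t i z, partialDeriv i (fun z => η (t * V z)) z =
      t * deriv η (t * V z) * partialDeriv i V z := fun t i z => by
    rw [partialDeriv_comp (θ := fun s => η (t * s)) (contDiff_comp_const_mul hη t) hV.contDiff]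
    beta_reduce
    rw [deriv_comp_mul_left, smul_eq_mul]
  have hF : ∀ t z, diffusionGenerator A B (fun z => η (t * V z) * g z) z =
      η (t * V z) * diffusionGenerator A B g z +
        g z * (t * (deriv η (t * V z) * diffusionGenerator A B V z) +
          t ^ 2 * (deriv (deriv η) (t * V z) * carreDuChamp B V z)) +
        ∑ i, ∑ j, ((1 / 2 : ℝ) • (B * Bᵀ)) i j *
          (t * deriv η (t * V z) * partialDeriv i V z * partialDeriv j g z +
            partialDeriv i g z * (t * deriv η (t * V z) * partialDeriv j V z)) := fun t z => by
    rw [diffusionGenerator_mul A B (hf t) hg,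
      diffusionGenerator_comp_const_mul A B hη hV.contDiff]
    simp only [hpf]
  have hη'c := (contDiff_deriv_of_contDiff hη).continuous
  have hη''c := (contDiff_deriv_of_contDiff (contDiff_deriv_of_contDiff hη)).continuous
  have hηc := hη.continuous
  have hlim : Tendsto (fun n => ∫ z, diffusionGenerator A B (fun z => η (ε n * V z) * g z) z ∂π)
      atTop (𝓝 (∫ z, η 0 * diffusionGenerator A B g z ∂π)) := by
    refine tendsto_integral_of_dominated_convergence
      (fun z => K * |diffusionGenerator A B g z| +
        (G * (K * (C * (1 + V z)) + K * (T * C * V z)) + T * (2 * (K * (1 + C * V z) * G))))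
      (fun n => (Continuous.diffusionGenerator hA B
        ((hf (ε n)).mul hg)).aestronglyMeasurable) ?_ ?_ ?_
    · exact (hLg.abs.const_mul K).add (by fun_prop)
    · refine fun n => ae_of_all _ fun z => ?_
      have hVz := hV.nonneg z
      obtain ⟨hk0, hk1, hk2⟩ := hK (ε n * V z) (mul_nonneg (hε n).le hVz)
      have hεa : |ε n| ≤ 1 := by rw [abs_of_pos (hε n)]; exact hε1 n
      have hεa2 : |ε n ^ 2| ≤ 1 := by
        rw [abs_pow]
        exact pow_le_one₀ (abs_nonneg _) hεa
      have hεη : |ε n * deriv η (ε n * V z)| ≤ K := by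
        rw [abs_mul]
        calc _ ≤ 1 * K := by gcongr
          _ = K := one_mul K
      rw [hF, Real.norm_eq_abs]
      refine (abs_add_le _ _).trans ((add_le_add (abs_add_le _ _) le_rfl).trans ?_)
      rw [add_assoc]
      refine add_le_add ?_ (add_le_add ?_ ?_)
      · rw [abs_mul]
        gcongr
      · rw [abs_mul]
        refine mul_le_mul (hG z) ((abs_add_le _ _).trans (add_le_add ?_ ?_)) (abs_nonneg _) hG0
        · rw [← mul_assoc, abs_mul]
          exact mul_le_mul hεη (hV.abs_generator_le z) (abs_nonneg _) hK0
        · rw [← mul_assoc, abs_mul, abs_mul]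
          refine mul_le_mul ?_ (hV.abs_carreDuChamp_le z) (abs_nonneg _) hK0
          calc _ ≤ 1 * K := by gcongr
            _ = K := one_mul K
      · rw [hT, Finset.sum_mul]
        refine (Finset.abs_sum_le_sum_abs _ _).trans (Finset.sum_le_sum fun i _ => ?_)
        rw [Finset.sum_mul]
        refine (Finset.abs_sum_le_sum_abs _ _).trans (Finset.sum_le_sum fun j _ => ?_)
        rw [abs_mul]
        refine mul_le_mul_of_nonneg_left ?_ (abs_nonneg _)
        refine (abs_add_le _ _).trans ?_
        have hb : ∀ i, |ε n * deriv η (ε n * V z) * partialDeriv i V z| ≤ K * (1 + C * V z) :=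
          fun i => by
            rw [abs_mul]
            exact mul_le_mul hεη (hV.abs_partialDeriv_le i z) (abs_nonneg _) hK0
        have hnn : 0 ≤ K * (1 + C * V z) := by positivity
        have h1 : |ε n * deriv η (ε n * V z) * partialDeriv i V z * partialDeriv j g z| ≤
            K * (1 + C * V z) * G := by
          rw [abs_mul]
          exact mul_le_mul (hb i) (hG' j z) (abs_nonneg _) hnn
        have h2 : |partialDeriv i g z * (ε n * deriv η (ε n * V z) * partialDeriv j V z)| ≤
            K * (1 + C * V z) * G := by
          rw [abs_mul, mul_comm]
          exact mul_le_mul (hb j) (hG' i z) (abs_nonneg _) hnn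
        linarith
    · refine ae_of_all _ fun z => ?_
      simp only [hF]
      have hcont : Continuous fun t : ℝ => η (t * V z) * diffusionGenerator A B g z +
        g z * (t * (deriv η (t * V z) * diffusionGenerator A B V z) +
          t ^ 2 * (deriv (deriv η) (t * V z) * carreDuChamp B V z)) +
        ∑ i, ∑ j, ((1 / 2 : ℝ) • (B * Bᵀ)) i j *
          (t * deriv η (t * V z) * partialDeriv i V z * partialDeriv j g z +
            partialDeriv i g z * (t * deriv η (t * V z) * partialDeriv j V z)) := by
        fun_prop
      simpa [Function.comp_def] using (hcont.tendsto 0).comp hεlim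
  have h0 : ∀ n, ∫ z, diffusionGenerator A B (fun z => η (ε n * V z) * g z) z ∂π = 0 := fun n =>
    hπ _ ((hf _).mul hg)
      (hV.hasCompactSupport_comp (fun s hs => (hzero s hs).1) (hε n) hC).mul_right
  simp only [h0] at hlim
  have h1 := tendsto_nhds_unique hlim tendsto_const_nhds
  rw [integral_const_mul] at h1
  exact (mul_eq_zero.1 h1).resolve_left hη0.ne'

end IsQuadraticLyapunov

end Lyapunov

/-! ### The characteristic function of a stationary law. -/

section CharFun

open Filter Topology

variable {ι κ : Type*} [Fintype ι]

theorem contDiff_inner_const (ξ : EuclideanSpace ℝ ι) :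
    ContDiff ℝ ∞ fun z : EuclideanSpace ℝ ι => inner ℝ z ξ :=
  contDiff_id.inner ℝ contDiff_const

/-- The quadratic form `x ↦ ∑ i j, S i j * x i * x j`. -/
noncomputable def quadForm (S : Matrix ι ι ℝ) (x : EuclideanSpace ℝ ι) : ℝ :=
  ∑ i, ∑ j, S i j * (x i * x j)

theorem hasDerivAt_quadForm_comp {S : Matrix ι ι ℝ} {x : ℝ → EuclideanSpace ℝ ι}
    {x' : EuclideanSpace ℝ ι} {t : ℝ} (hx : HasDerivAt x x' t) :
    HasDerivAt (fun t => quadForm S (x t))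
      (x'.ofLp ⬝ᵥ S *ᵥ (x t).ofLp + (x t).ofLp ⬝ᵥ S *ᵥ x'.ofLp) t := by
  have hi : ∀ i, HasDerivAt (fun t => x t i) (x' i) t := fun i =>
    (EuclideanSpace.proj (𝕜 := ℝ) i).hasFDerivAt.comp_hasDerivAt t hx
  have := HasDerivAt.fun_sum fun i (_ : i ∈ Finset.univ) => HasDerivAt.fun_sum
    fun j (_ : j ∈ Finset.univ) => ((hi i).fun_mul (hi j)).const_mul (S i j)
  refine this.congr_deriv ?_
  simp only [dotProduct, Matrix.mulVec, Finset.mul_sum, ← Finset.sum_add_distrib]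
  exact Finset.sum_congr rfl fun i _ => Finset.sum_congr rfl fun j _ => by ring

theorem quadForm_eq_dotProduct (S : Matrix ι ι ℝ) (x : EuclideanSpace ℝ ι) :
    quadForm S x = x.ofLp ⬝ᵥ S *ᵥ x.ofLp := by
  simp only [quadForm, dotProduct, Matrix.mulVec, Finset.mul_sum]
  exact Finset.sum_congr rfl fun i _ => Finset.sum_congr rfl fun j _ => by ring

variable [DecidableEq ι] [Fintype κ]

theorem partialDeriv_inner (ξ : EuclideanSpace ℝ ι) (i : ι) :
    partialDeriv i (fun z => inner ℝ z ξ) = fun _ => ξ i := by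
  ext z
  have h : (fun z : EuclideanSpace ℝ ι => inner ℝ z ξ) = innerSL ℝ ξ := by
    ext z
    simp [real_inner_comm]
  rw [partialDeriv, h, ContinuousLinearMap.fderiv]
  simp [PiLp.inner_apply]

theorem diffusionGenerator_comp_inner (A : EuclideanSpace ℝ ι → EuclideanSpace ℝ ι)
    (B : Matrix ι κ ℝ) {θ : ℝ → ℝ} (hθ : ContDiff ℝ ∞ θ) (ξ z : EuclideanSpace ℝ ι) :
    diffusionGenerator A B (fun z => θ (inner ℝ z ξ)) z =
      -(deriv θ (inner ℝ z ξ) * inner ℝ (A z) ξ) +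
        deriv (deriv θ) (inner ℝ z ξ) * quadForm ((1 / 2 : ℝ) • (B * Bᵀ)) ξ := by
  have h : diffusionGenerator A B (fun z => inner ℝ z ξ) z = -inner ℝ (A z) ξ := by
    have hc : ∀ (i : ι) (c : ℝ) (z : EuclideanSpace ℝ ι), partialDeriv i (fun _ => c) z = 0 :=
      fun i c z => by simp [partialDeriv]
    rw [diffusionGenerator_eq]
    simp only [partialDeriv_inner, hc]
    simp [PiLp.inner_apply, mul_comm]
  rw [diffusionGenerator_comp A B hθ (contDiff_inner_const ξ), h]
  simp only [partialDeriv_inner, quadForm]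
  ring

namespace IsQuadraticLyapunov

variable {A : EuclideanSpace ℝ ι →L[ℝ] EuclideanSpace ℝ ι} {B : Matrix ι κ ℝ}
  {V : EuclideanSpace ℝ ι → ℝ} {C m : ℝ}

theorem integrable_norm (hV : IsQuadraticLyapunov A B V C m) (hC : 0 ≤ C)
    {π : Measure (EuclideanSpace ℝ ι)} (hπ : IsStationarySolution A B π) :
    Integrable (fun z => ‖z‖) π := by
  have := ((isStationarySolution_iff _ _ _).1 hπ).1
  have hVi := hV.integrable A.continuous hC hπ
  refine ((hVi.const_mul C).add (integrable_const 1)).mono' (by fun_prop)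
    (ae_of_all _ fun z => ?_)
  have := hV.norm_sq_le z
  simp only [norm_norm, Pi.add_apply]
  nlinarith [sq_nonneg (‖z‖ - 1)]

theorem integral_generator_comp_inner (hV : IsQuadraticLyapunov A B V C m) (hC : 0 ≤ C)
    {π : Measure (EuclideanSpace ℝ ι)} (hπ : IsStationarySolution A B π)
    {θ : ℝ → ℝ} (hθ : ContDiff ℝ ∞ θ) (h0 : ∀ s, |θ s| ≤ 1) (h1 : ∀ s, |deriv θ s| ≤ 1)
    (h2 : ∀ s, |deriv (deriv θ) s| ≤ 1) (ξ : EuclideanSpace ℝ ι) :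
    Integrable (fun z => -(deriv θ (inner ℝ z ξ) * inner ℝ (A z) ξ) +
      deriv (deriv θ) (inner ℝ z ξ) * quadForm ((1 / 2 : ℝ) • (B * Bᵀ)) ξ) π ∧
    ∫ z, (-(deriv θ (inner ℝ z ξ) * inner ℝ (A z) ξ) +
      deriv (deriv θ) (inner ℝ z ξ) * quadForm ((1 / 2 : ℝ) • (B * Bᵀ)) ξ) ∂π = 0 := by
  have := ((isStationarySolution_iff _ _ _).1 hπ).1
  have hn := hV.integrable_norm hC hπ
  have hθ' := contDiff_deriv_of_contDiff hθ
  have hc1 := hθ'.continuous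
  have hc2 := (contDiff_deriv_of_contDiff hθ').continuous
  have hint : Integrable (fun z => -(deriv θ (inner ℝ z ξ) * inner ℝ (A z) ξ) +
      deriv (deriv θ) (inner ℝ z ξ) * quadForm ((1 / 2 : ℝ) • (B * Bᵀ)) ξ) π := by
    refine Integrable.add (Integrable.neg ?_) (Integrable.mul_const ?_ _)
    · refine (hn.const_mul (‖A‖ * ‖ξ‖)).mono' (by fun_prop) (ae_of_all _ fun z => ?_)
      rw [norm_mul]
      calc ‖deriv θ (inner ℝ z ξ)‖ * ‖inner ℝ (A z) ξ‖ ≤ 1 * (‖A‖ * ‖z‖ * ‖ξ‖) := by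
            gcongr
            · exact h1 _
            · exact (norm_inner_le_norm _ _).trans (by gcongr; exact A.le_opNorm z)
        _ = ‖A‖ * ‖ξ‖ * ‖z‖ := by ring
    · exact Integrable.of_bound (by fun_prop) 1 (ae_of_all _ fun z => h2 _)
  refine ⟨hint, ?_⟩
  simp only [← diffusionGenerator_comp_inner A B hθ] at hint ⊢
  refine hV.integral_generator_eq_zero A.continuous hC hπ (G := max 1 ‖ξ‖)
    (hθ.comp (contDiff_inner_const ξ)) (fun z => (h0 _).trans (le_max_left _ _))
    (fun i z => ?_) hint
  rw [partialDeriv_comp hθ (contDiff_inner_const ξ), partialDeriv_inner, abs_mul]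
  calc |deriv θ (inner ℝ z ξ)| * |ξ i| ≤ 1 * ‖ξ‖ := by
        gcongr
        · exact h1 _
        · exact PiLp.norm_apply_le ξ i
    _ = ‖ξ‖ := one_mul _
    _ ≤ _ := le_max_right _ _

/-- This is $\int L\,e^{i\langle z,\xi\rangle}d\pi=0$, assembled from its cosine and sine parts. -/
theorem integral_cexp_mul_inner (hV : IsQuadraticLyapunov A B V C m) (hC : 0 ≤ C)
    {π : Measure (EuclideanSpace ℝ ι)} (hπ : IsStationarySolution A B π)
    (ξ : EuclideanSpace ℝ ι) :
    ∫ z, Complex.exp (inner ℝ z ξ * Complex.I) * (-(inner ℝ (A z) ξ : ℝ) * Complex.I) ∂π =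
      quadForm ((1 / 2 : ℝ) • (B * Bᵀ)) ξ * charFun π ξ := by
  have := ((isStationarySolution_iff _ _ _).1 hπ).1
  set Q := quadForm ((1 / 2 : ℝ) • (B * Bᵀ)) ξ with hQ
  obtain ⟨hci, hc⟩ := hV.integral_generator_comp_inner hC hπ Real.contDiff_cos
    Real.abs_cos_le_one (by simp [Real.abs_sin_le_one])
    (by simp [Real.deriv_cos', Real.abs_cos_le_one]) ξ
  obtain ⟨hsi, hs⟩ := hV.integral_generator_comp_inner hC hπ Real.contDiff_sin
    Real.abs_sin_le_one (by simp [Real.abs_cos_le_one])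
    (by simp [Real.abs_sin_le_one]) ξ
  simp only [← hQ] at hci hc hsi hs
  have hei : Integrable (fun z => Complex.exp (inner ℝ z ξ * Complex.I)) π :=
    Integrable.of_bound (by fun_prop) 1
      (ae_of_all _ fun z => (Complex.norm_exp_ofReal_mul_I _).le)
  have hpt : ∀ z, Complex.exp (inner ℝ z ξ * Complex.I) *
      (-(inner ℝ (A z) ξ : ℝ) * Complex.I) =
      (((-(deriv Real.cos (inner ℝ z ξ) * inner ℝ (A z) ξ) +
        deriv (deriv Real.cos) (inner ℝ z ξ) * Q : ℝ) : ℂ) +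
      ((-(deriv Real.sin (inner ℝ z ξ) * inner ℝ (A z) ξ) +
        deriv (deriv Real.sin) (inner ℝ z ξ) * Q : ℝ) : ℂ) * Complex.I) +
      Q * Complex.exp (inner ℝ z ξ * Complex.I) := fun z => by
    have e1 : deriv (deriv Real.cos) (inner ℝ z ξ) = -Real.cos (inner ℝ z ξ) := by
      simp [Real.deriv_cos']
    have e2 : deriv (deriv Real.sin) (inner ℝ z ξ) = -Real.sin (inner ℝ z ξ) := by
      simp
    rw [e1, e2, Real.deriv_cos, Real.deriv_sin, Complex.exp_mul_I]
    push_cast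
    linear_combination (-(inner ℝ (A z) ξ : ℂ) * Complex.sin (inner ℝ z ξ : ℝ)) * Complex.I_sq
  have hsum : ∀ a b : EuclideanSpace ℝ ι → ℝ, Integrable a π → Integrable b π →
      ∫ z, a z ∂π = 0 → ∫ z, b z ∂π = 0 →
      ∫ z, ((a z : ℂ) + b z * Complex.I + Q * Complex.exp (inner ℝ z ξ * Complex.I)) ∂π =
        Q * charFun π ξ := fun a b ha hb ha0 hb0 => by
    have ha' : Integrable (fun z => (a z : ℂ)) π := ha.ofReal
    have hb' : Integrable (fun z => (b z : ℂ) * Complex.I) π := hb.ofReal.mul_const _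
    rw [integral_add (f := fun z => (a z : ℂ) + b z * Complex.I) (ha'.add hb')
      (hei.const_mul _), integral_add ha' hb', integral_mul_const,
      integral_const_mul, integral_complex_ofReal, integral_complex_ofReal, ha0, hb0,
      charFun_apply]
    simp
  simp only [hpt]
  exact hsum _ _ hci hsi hc hs

/-- Moving the frequency by $-A^*x$ differentiates $e^{i\langle z,x\rangle}$ to exactly the drift
term of the previous identity. The first moment of $\pi$ justifies differentiating under the
integral. -/
theorem hasDerivAt_charFun_comp (hV : IsQuadraticLyapunov A B V C m) (hC : 0 ≤ C)
    {π : Measure (EuclideanSpace ℝ ι)} (hπ : IsStationarySolution A B π)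
    {x : ℝ → EuclideanSpace ℝ ι}
    (hx : ∀ t, HasDerivAt x (-(ContinuousLinearMap.adjoint A (x t))) t) (t : ℝ) :
    HasDerivAt (fun t => charFun π (x t))
      (quadForm ((1 / 2 : ℝ) • (B * Bᵀ)) (x t) * charFun π (x t)) t := by
  have := ((isStationarySolution_iff _ _ _).1 hπ).1
  have hn := hV.integrable_norm hC hπ
  have hxc : Continuous x := continuous_iff_continuousAt.2 fun t => (hx t).continuousAt
  rw [← hV.integral_cexp_mul_inner hC hπ]
  simp only [charFun_apply]
  obtain ⟨R, hR⟩ : ∃ R, ∀ s ∈ Metric.closedBall t 1, ‖ContinuousLinearMap.adjoint A (x s)‖ ≤ R :=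
    (isCompact_closedBall t 1).exists_bound_of_continuousOn (by fun_prop)
  have hA : ∀ z s, inner ℝ z (-(ContinuousLinearMap.adjoint A (x s))) = -inner ℝ (A z) (x s) :=
    fun z s => by rw [inner_neg_right, ContinuousLinearMap.adjoint_inner_right]
  refine (hasDerivAt_integral_of_dominated_loc_of_deriv_le (bound := fun z => R * ‖z‖)
    (F := fun s z => Complex.exp (inner ℝ z (x s) * Complex.I))
    (F' := fun s z => Complex.exp (inner ℝ z (x s) * Complex.I) *
      (-(inner ℝ (A z) (x s) : ℝ) * Complex.I))
    (Metric.closedBall_mem_nhds t one_pos) (Eventually.of_forall fun s => by fun_prop)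
    ?_ (by fun_prop) (ae_of_all _ fun z s hs => ?_) (hn.const_mul R)
    (ae_of_all _ fun z s _ => ?_)).2
  · exact Integrable.of_bound (by fun_prop) 1
      (ae_of_all _ fun z => (Complex.norm_exp_ofReal_mul_I _).le)
  · rw [norm_mul, Complex.norm_exp_ofReal_mul_I, one_mul, norm_mul, Complex.norm_I, mul_one,
      norm_neg, Complex.norm_real, ← norm_neg, ← hA, mul_comm R]
    refine (norm_inner_le_norm _ _).trans ?_
    rw [norm_neg]
    gcongr
    exact hR s hs
  · have h1 := ((hasDerivAt_const s z).inner ℝ (hx s)).ofReal_comp.mul_const Complex.I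
    refine h1.cexp.congr_deriv ?_
    rw [hA]
    simp

end IsQuadraticLyapunov

/-- A stationary solution of a stable Ornstein-Uhlenbeck equation has the characteristic function
of the centred Gaussian whose covariance solves the Lyapunov equation. -/
theorem charFun_of_isStationarySolution {A S : Matrix ι ι ℝ} {B : Matrix ι κ ℝ}
    {V : EuclideanSpace ℝ ι → ℝ} {C m : ℝ}
    (hV : IsQuadraticLyapunov (fun z => WithLp.toLp 2 (A *ᵥ z.ofLp)) B V C m) (hC : 0 ≤ C)
    (hS : A * S + S * Aᵀ = B * Bᵀ) {π : Measure (EuclideanSpace ℝ ι)}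
    (hπ : IsStationarySolution (fun z => WithLp.toLp 2 (A *ᵥ z.ofLp)) B π)
    (hdecay : ∀ x : ℝ → EuclideanSpace ℝ ι,
      (∀ t, HasDerivAt x (-(WithLp.toLp 2 (Aᵀ *ᵥ (x t).ofLp))) t) → Tendsto x atTop (𝓝 0))
    (ξ : EuclideanSpace ℝ ι) :
    charFun π ξ = Complex.exp (-(quadForm S ξ / 2 : ℝ)) := by
  have := ((isStationarySolution_iff _ _ _).1 hπ).1
  set L : EuclideanSpace ℝ ι →L[ℝ] EuclideanSpace ℝ ι := Matrix.toEuclideanCLM (𝕜 := ℝ) A with hL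
  have hLA : (fun z : EuclideanSpace ℝ ι => WithLp.toLp 2 (A *ᵥ z.ofLp)) = L := by
    ext z
    simp [hL]
  rw [hLA] at hV hπ
  have hadj : ∀ z, ContinuousLinearMap.adjoint L z = WithLp.toLp 2 (Aᵀ *ᵥ z.ofLp) := fun z => by
    rw [hL, ← ContinuousLinearMap.star_eq_adjoint, ← map_star]
    ext i
    simp [Matrix.star_eq_conjTranspose]
  set x : ℝ → EuclideanSpace ℝ ι :=
    fun t => NormedSpace.exp (t • -(ContinuousLinearMap.adjoint L)) ξ with hxdef
  have hx : ∀ t, HasDerivAt x (-(ContinuousLinearMap.adjoint L (x t))) t := fun t => by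
    have h := hasDerivAt_exp_smul_const' (𝕂 := ℝ) (-(ContinuousLinearMap.adjoint L)) t
    exact h.clm_apply (hasDerivAt_const t ξ) |>.congr_deriv (by simp [hxdef])
  have hx0 : x 0 = ξ := by simp [hxdef]
  have hlim : Tendsto x atTop (𝓝 0) := hdecay x fun t => by
    rw [← hadj]
    exact hx t
  have hq : ∀ t, HasDerivAt (fun t => quadForm S (x t))
      (-2 * quadForm ((1 / 2 : ℝ) • (B * Bᵀ)) (x t)) t := fun t => by
    refine (hasDerivAt_quadForm_comp (hx t)).congr_deriv ?_
    rw [quadForm_eq_dotProduct, hadj, ← hS]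
    simp only [WithLp.ofLp_neg, Matrix.mulVec_neg, dotProduct_neg,
      neg_dotProduct, Matrix.smul_mulVec, Matrix.add_mulVec, dotProduct_smul, dotProduct_add,
      ← Matrix.mulVec_mulVec, smul_eq_mul]
    rw [Matrix.mulVec_transpose, ← Matrix.dotProduct_mulVec]
    ring
  -- By the Lyapunov equation the exponent $S(x_t)/2$ has derivative $-Q(x_t)$, with $Q$ the form of
  -- $\frac12BB^T$; this cancels the growth rate of the characteristic function.
  set F : ℝ → ℂ := fun t => charFun π (x t) * Complex.exp ((quadForm S (x t) / 2 : ℝ)) with hF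
  have hFd : ∀ t, HasDerivAt F 0 t := fun t => by
    have h1 := ((hq t).div_const 2).ofReal_comp.cexp
    refine ((hV.hasDerivAt_charFun_comp hC hπ hx t).mul h1).congr_deriv ?_
    push_cast
    ring
  have hconst : ∀ t, F t = F 0 := fun t =>
    is_const_of_deriv_eq_zero (fun t => (hFd t).differentiableAt) (fun t => (hFd t).deriv) t 0
  have hFc : Continuous fun y : EuclideanSpace ℝ ι =>
      charFun π y * Complex.exp ((quadForm S y / 2 : ℝ)) := by
    have : Continuous (charFun π) := continuous_charFun
    unfold quadForm
    fun_prop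
  have hFlim : Tendsto F atTop (𝓝 1) := by
    have := (hFc.tendsto 0).comp hlim
    simpa [quadForm, Function.comp_def, hF] using this
  have h1 : F 0 = 1 := by
    refine tendsto_nhds_unique ?_ hFlim
    rw [show F = fun _ => F 0 from funext hconst]
    exact tendsto_const_nhds
  simp only [hF, hx0] at h1
  rw [Complex.exp_neg]
  exact eq_inv_of_mul_eq_one_left h1

end CharFun

/-! ### The primal-dual drift and the obstruction to a universal noise matrix. -/

section PrimalDual

open Filter Topology

theorem hasFDerivAt_coord (i : Fin 2) (z : EuclideanSpace ℝ (Fin 2)) :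
    HasFDerivAt (fun z : EuclideanSpace ℝ (Fin 2) => z i)
      (EuclideanSpace.proj (𝕜 := ℝ) i : EuclideanSpace ℝ (Fin 2) →L[ℝ] ℝ) z :=
  (EuclideanSpace.proj (𝕜 := ℝ) i : EuclideanSpace ℝ (Fin 2) →L[ℝ] ℝ).hasFDerivAt

theorem partialDeriv_linear (a b : ℝ) (i : Fin 2) :
    partialDeriv i (fun z => a * z 0 + b * z 1) = fun _ => ![a, b] i := by
  ext z
  rw [partialDeriv, (((hasFDerivAt_coord 0 z).const_mul a).fun_add
    ((hasFDerivAt_coord 1 z).const_mul b)).fderiv]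
  fin_cases i <;> simp

theorem partialDeriv_quadratic (a b : ℝ) (i : Fin 2) :
    partialDeriv i (fun z => a * z 0 ^ 2 + b * z 1 ^ 2) =
      fun z => ![2 * a, 0] i * z 0 + ![0, 2 * b] i * z 1 := by
  ext z
  have h : ∀ i, HasFDerivAt (fun z : EuclideanSpace ℝ (Fin 2) => z i ^ 2)
      ((2 * z i) • (EuclideanSpace.proj (𝕜 := ℝ) i : EuclideanSpace ℝ (Fin 2) →L[ℝ] ℝ)) z :=
    fun i => by simpa using (hasFDerivAt_coord i z).pow 2
  rw [partialDeriv, (((h 0).const_mul a).fun_add ((h 1).const_mul b)).fderiv]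
  fin_cases i <;> simp <;> ring

/-- The weight $\lambda$ on $x^2$ makes the cross terms $\pm2\lambda k\,xy$ of the drift cancel. -/
theorem diffusionGenerator_pdDrift_quadratic (lam cf cg k : ℝ) (B : Matrix (Fin 2) (Fin 2) ℝ)
    (z : EuclideanSpace ℝ (Fin 2)) :
    diffusionGenerator (pdDrift lam cf cg k) B (fun z => lam * z 0 ^ 2 + 1 * z 1 ^ 2) z =
      (lam * (B * Bᵀ) 0 0 + (B * Bᵀ) 1 1) -
        2 * (lam * cg⁻¹ * z 0 ^ 2 + lam * cf * z 1 ^ 2) := by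
  rw [diffusionGenerator_eq]
  simp only [partialDeriv_quadratic, partialDeriv_linear, Fin.sum_univ_two, pdDrift, pdMatrix]
  simp [Matrix.mulVec, dotProduct, Fin.sum_univ_two]
  ring

theorem exists_isQuadraticLyapunov_pdDrift {lam cf cg : ℝ} (hlam : 0 < lam) (hcf : 0 < cf)
    (hcg : 0 < cg) (k : ℝ) (B : Matrix (Fin 2) (Fin 2) ℝ) :
    ∃ C m : ℝ, 0 ≤ C ∧ IsQuadraticLyapunov (pdDrift lam cf cg k) B
      (fun z => lam * z 0 ^ 2 + 1 * z 1 ^ 2) C m := by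
  set D := lam * (B * Bᵀ) 0 0 + (B * Bᵀ) 1 1 with hD
  set p := cg⁻¹ with hp
  have hp0 : 0 < p := inv_pos.2 hcg
  have hq0 : 0 < lam * cf := mul_pos hlam hcf
  have hl0 : 0 < lam⁻¹ := inv_pos.2 hlam
  have hV0 : ∀ z : EuclideanSpace ℝ (Fin 2), 0 ≤ lam * z 0 ^ 2 + 1 * z 1 ^ 2 :=
    fun z => by positivity
  have hle : ∀ {c : ℝ} (z : EuclideanSpace ℝ (Fin 2)),
      c ≤ |D| + 2 * (p + lam * cf) + (lam⁻¹ + 1) + (4 * lam + 4) →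
      c * (lam * z 0 ^ 2 + 1 * z 1 ^ 2) ≤
        (|D| + 2 * (p + lam * cf) + (lam⁻¹ + 1) + (4 * lam + 4)) *
          (lam * z 0 ^ 2 + 1 * z 1 ^ 2) :=
    fun z h => mul_le_mul_of_nonneg_right h (hV0 z)
  have hD0 := abs_nonneg D
  -- The constant sums nonnegative quantities, one group for each inequality required of $C$; $m$ is
  -- twice the smaller diagonal rate.
  refine ⟨|D| + 2 * (p + lam * cf) + (lam⁻¹ + 1) + (4 * lam + 4), 2 * min p (lam * cf),
    by positivity, ⟨by fun_prop, hV0, fun z => ?_, fun i z => ?_, by positivity, fun z => ?_,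
      fun z => ?_⟩⟩
  · refine le_trans ?_ (hle (c := lam⁻¹ + 1) z (by linarith))
    rw [EuclideanSpace.norm_sq_eq]
    simp only [Fin.sum_univ_two, Real.norm_eq_abs, sq_abs]
    have e : (lam⁻¹ + 1) * (lam * z 0 ^ 2 + 1 * z 1 ^ 2) =
        z 0 ^ 2 + z 1 ^ 2 + (lam * z 0 ^ 2 + lam⁻¹ * z 1 ^ 2) := by
      field_simp
      ring
    rw [e]
    have : 0 ≤ lam * z 0 ^ 2 + lam⁻¹ * z 1 ^ 2 := by positivity
    linarith
  · refine le_trans ?_ (hle (c := 4 * lam + 4) z (by linarith))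
    rw [partialDeriv_quadratic]
    have h0 := mul_nonneg hlam.le (sq_nonneg (z 1))
    have h1 := mul_nonneg hlam.le (sq_nonneg (z 0))
    fin_cases i <;> simp <;> nlinarith [sq_nonneg (z 0), sq_nonneg (z 1),
      sq_nonneg (lam * z 0)]
  · rw [diffusionGenerator_pdDrift_quadratic, ← hD, ← hp]
    have h1 : min p (lam * cf) * (lam * z 0 ^ 2) ≤ p * (lam * z 0 ^ 2) := by
      gcongr
      exact min_le_left _ _
    have h2 : min p (lam * cf) * z 1 ^ 2 ≤ lam * cf * z 1 ^ 2 := by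
      gcongr
      exact min_le_right _ _
    have := le_abs_self D
    linarith
  · rw [diffusionGenerator_pdDrift_quadratic, ← hD, ← hp]
    have h1 : 0 ≤ p * (lam * z 0 ^ 2) := by positivity
    have h2 : 0 ≤ p * z 1 ^ 2 := by positivity
    have h3 : 0 ≤ lam * cf * z 1 ^ 2 := by positivity
    have h4 : 0 ≤ lam * cf * (lam * z 0 ^ 2) := by positivity
    have h5 := hle (c := 2 * (p + lam * cf)) z (by linarith)
    have h6 := le_abs_self D
    have h7 := neg_abs_le D
    rw [abs_le]
    constructor <;> linarith

/-- For the transposed flow the cross terms cancel in $x_0^2+\lambda x_1^2$, the form dual to $V$ up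
to scale. It therefore decays at rate $2\min(c_g^{-1},\lambda c_f)$. -/
theorem tendsto_zero_of_hasDerivAt_pdMatrix {lam cf cg k : ℝ} (hlam : 0 < lam) (hcf : 0 < cf)
    (hcg : 0 < cg) (x : ℝ → EuclideanSpace ℝ (Fin 2))
    (hx : ∀ t, HasDerivAt x
      (-(WithLp.toLp 2 ((pdMatrix lam cf cg k)ᵀ *ᵥ (x t).ofLp))) t) :
    Tendsto x atTop (𝓝 0) := by
  set p := cg⁻¹ with hp
  have hp0 : 0 < p := inv_pos.2 hcg
  have hq0 : 0 < lam * cf := mul_pos hlam hcf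
  set m := min p (lam * cf) with hm
  have hm0 : 0 < m := lt_min hp0 hq0
  have hi : ∀ i t, HasDerivAt (fun t => x t i)
      ((-(WithLp.toLp 2 ((pdMatrix lam cf cg k)ᵀ *ᵥ (x t).ofLp)) : EuclideanSpace ℝ (Fin 2)) i)
      t := fun i t => (EuclideanSpace.proj (𝕜 := ℝ) i).hasFDerivAt.comp_hasDerivAt t (hx t)
  have h0 : ∀ t, HasDerivAt (fun t => x t 0) (-(p * x t 0 - lam * k * x t 1)) t := fun t => by
    refine (hi 0 t).congr_deriv ?_
    simp [pdMatrix, hp]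
    ring
  have h1 : ∀ t, HasDerivAt (fun t => x t 1) (-(k * x t 0 + lam * cf * x t 1)) t := fun t => by
    refine (hi 1 t).congr_deriv ?_
    simp [pdMatrix]
  have hW : ∀ t, HasDerivAt (fun t => Real.exp (2 * m * t) * (x t 0 ^ 2 + lam * x t 1 ^ 2))
      (Real.exp (2 * m * t) * (2 * ((m - p) * x t 0 ^ 2 +
        lam * ((m - lam * cf) * x t 1 ^ 2)))) t := fun t => by
    have he : HasDerivAt (fun t => Real.exp (2 * m * t)) (Real.exp (2 * m * t) * (2 * m)) t := by
      simpa using ((hasDerivAt_id t).const_mul (2 * m)).exp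
    refine (he.fun_mul (((h0 t).fun_pow 2).fun_add (((h1 t).fun_pow 2).const_mul lam))).congr_deriv
      ?_
    push_cast
    ring
  have hanti : Antitone fun t => Real.exp (2 * m * t) * (x t 0 ^ 2 + lam * x t 1 ^ 2) := by
    refine antitone_of_hasDerivAt_nonpos hW fun t => ?_
    refine mul_nonpos_of_nonneg_of_nonpos (Real.exp_pos _).le ?_
    have e1 : (m - p) * x t 0 ^ 2 ≤ 0 :=
      mul_nonpos_of_nonpos_of_nonneg (sub_nonpos.2 (min_le_left _ _)) (sq_nonneg _)
    have e2 : lam * ((m - lam * cf) * x t 1 ^ 2) ≤ 0 :=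
      mul_nonpos_of_nonneg_of_nonpos hlam.le
        (mul_nonpos_of_nonpos_of_nonneg (sub_nonpos.2 (min_le_right _ _)) (sq_nonneg _))
    linarith
  have hexp : Tendsto (fun t : ℝ => Real.exp (-(2 * m * t))) atTop (𝓝 0) :=
    Real.tendsto_exp_neg_atTop_nhds_zero.comp (tendsto_id.const_mul_atTop (by positivity))
  set W₀ := Real.exp (2 * m * 0) * (x 0 0 ^ 2 + lam * x 0 1 ^ 2) with hW₀
  have hnorm : ∀ t, 0 ≤ t → ‖x t‖ ^ 2 ≤ (1 + lam⁻¹) * (W₀ * Real.exp (-(2 * m * t))) :=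
      fun t ht => by
    have h := hanti ht
    have h' : x t 0 ^ 2 + lam * x t 1 ^ 2 ≤ W₀ * Real.exp (-(2 * m * t)) := by
      rw [Real.exp_neg, ← div_eq_mul_inv, le_div_iff₀' (Real.exp_pos _)]
      exact h
    refine le_trans ?_ (mul_le_mul_of_nonneg_left h' (by positivity))
    rw [EuclideanSpace.norm_sq_eq]
    simp only [Fin.sum_univ_two, Real.norm_eq_abs, sq_abs]
    have e : (1 + lam⁻¹) * (x t 0 ^ 2 + lam * x t 1 ^ 2) =
        x t 0 ^ 2 + x t 1 ^ 2 + (lam * x t 1 ^ 2 + lam⁻¹ * x t 0 ^ 2) := by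
      field_simp
      ring
    rw [e]
    have : 0 ≤ lam * x t 1 ^ 2 + lam⁻¹ * x t 0 ^ 2 := by positivity
    linarith
  have hsq : Tendsto (fun t => ‖x t‖ ^ 2) atTop (𝓝 0) := by
    refine squeeze_zero' (Eventually.of_forall fun t => by positivity)
      ((eventually_ge_atTop 0).mono hnorm) ?_
    simpa using (hexp.const_mul W₀).const_mul (1 + lam⁻¹)
  rw [tendsto_zero_iff_norm_tendsto_zero]
  simpa [Function.comp_def] using (Real.continuous_sqrt.tendsto 0).comp hsq

theorem exists_lyapunov_pdMatrix {lam cf cg : ℝ} (hlam : 0 < lam) (hcf : 0 < cf)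
    (hcg : 0 < cg) (k : ℝ) (B : Matrix (Fin 2) (Fin 2) ℝ) :
    ∃ M : Matrix (Fin 2) (Fin 4) ℝ,
      pdMatrix lam cf cg k * (M * Mᵀ) + M * Mᵀ * (pdMatrix lam cf cg k)ᵀ = B * Bᵀ := by
  refine exists_lyapunov_sqrt _ B ?_ ?_
  · simp only [pdMatrix, Matrix.trace_fin_two_of]
    positivity
  · simp only [pdMatrix, Matrix.det_fin_two_of]
    have : 0 < cg⁻¹ * (lam * cf) := by positivity
    nlinarith [mul_nonneg hlam.le (sq_nonneg k)]

theorem charFun_of_isStationarySolution_pdDrift {lam cf cg k : ℝ} (hlam : 0 < lam) (hcf : 0 < cf)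
    (hcg : 0 < cg) {B S : Matrix (Fin 2) (Fin 2) ℝ}
    (hS : pdMatrix lam cf cg k * S + S * (pdMatrix lam cf cg k)ᵀ = B * Bᵀ)
    {π : Measure (EuclideanSpace ℝ (Fin 2))}
    (hπ : IsStationarySolution (pdDrift lam cf cg k) B π) (ξ : EuclideanSpace ℝ (Fin 2)) :
    charFun π ξ = Complex.exp (-(quadForm S ξ / 2 : ℝ)) := by
  obtain ⟨C, m, hC, hV⟩ := exists_isQuadraticLyapunov_pdDrift hlam hcf hcg k B
  exact charFun_of_isStationarySolution hV hC hS hπ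
    (tendsto_zero_of_hasDerivAt_pdMatrix hlam hcf hcg) ξ

theorem existsUnique_isStationarySolution_pdDrift {lam cf cg : ℝ} (hlam : 0 < lam) (hcf : 0 < cf)
    (hcg : 0 < cg) (k : ℝ) (B : Matrix (Fin 2) (Fin 2) ℝ) :
    ∃! π : Measure (EuclideanSpace ℝ (Fin 2)),
      IsStationarySolution (pdDrift lam cf cg k) B π := by
  obtain ⟨M, hM⟩ := exists_lyapunov_pdMatrix hlam hcf hcg k B
  have hex := isStationarySolution_gaussianImage (n := 3) _ B M hM
  refine ⟨gaussianImage M, hex, fun π hπ => ?_⟩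
  have := ((isStationarySolution_iff _ _ _).1 hπ).1
  have := ((isStationarySolution_iff _ _ _).1 hex).1
  refine Measure.ext_of_charFun (funext fun ξ => ?_)
  rw [charFun_of_isStationarySolution_pdDrift hlam hcf hcg hM hπ,
    charFun_of_isStationarySolution_pdDrift hlam hcf hcg hM hex]

/-- Here $h(x)=\frac w2x^2$ with $w=k^2/c_f+c_g^{-1}$. -/
theorem gaussTarget_eq_gaussianReal {cf cg : ℝ} (hcf : 0 < cf) (hcg : 0 < cg) (k : ℝ) :
    gaussTarget cf cg k =
      ProbabilityTheory.gaussianReal 0 (Real.toNNReal (k ^ 2 / cf + cg⁻¹)⁻¹) := by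
  have hw : 0 < k ^ 2 / cf + cg⁻¹ := by positivity
  set w := k ^ 2 / cf + cg⁻¹ with hwdef
  have hv : Real.toNNReal w⁻¹ ≠ 0 := by simpa using hw
  have hexp : ∀ x, -gaussH cf cg k x = -(w / 2) * x ^ 2 := fun x => by
    simp only [gaussH, gaussF, gaussG, hwdef]
    field_simp
  rw [gaussTarget, Measure.tilted, ProbabilityTheory.gaussianReal_of_var_ne_zero _ hv]
  congr 1
  ext x
  simp only [hexp, integral_gaussian, ProbabilityTheory.gaussianPDF,
    ProbabilityTheory.gaussianPDFReal, Real.coe_toNNReal _ (inv_pos.2 hw).le]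
  congr 1
  rw [div_eq_inv_mul]
  congr 2
  · congr 1
    field_simp
  · simp only [sub_zero]
    field_simp

theorem charFun_xMarginal (π : Measure (EuclideanSpace ℝ (Fin 2))) (s : ℝ) :
    charFun (xMarginal π) s = charFun π (EuclideanSpace.single 0 s) := by
  rw [xMarginal, charFun_apply, charFun_apply, integral_map (by fun_prop) (by fun_prop)]
  have h : ∀ z : EuclideanSpace ℝ (Fin 2),
      inner ℝ z (EuclideanSpace.single 0 s) = inner ℝ (z 0) s := fun z => by
    simp [EuclideanSpace.inner_single_right]
  simp only [h]

/-- Both laws on the line are centred Gaussians, so comparing characteristic functions at the single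
point $1$ determines the variance. -/
theorem covariance_of_xMarginal_eq_gaussTarget {lam cf cg k : ℝ} (hlam : 0 < lam) (hcf : 0 < cf)
    (hcg : 0 < cg) {B S : Matrix (Fin 2) (Fin 2) ℝ}
    (hS : pdMatrix lam cf cg k * S + S * (pdMatrix lam cf cg k)ᵀ = B * Bᵀ)
    {π : Measure (EuclideanSpace ℝ (Fin 2))}
    (hπ : IsStationarySolution (pdDrift lam cf cg k) B π)
    (hx : xMarginal π = gaussTarget cf cg k) : S 0 0 = (k ^ 2 / cf + cg⁻¹)⁻¹ := by
  have hw : 0 < k ^ 2 / cf + cg⁻¹ := by positivity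
  have h := charFun_xMarginal π 1
  rw [hx, gaussTarget_eq_gaussianReal hcf hcg, ProbabilityTheory.charFun_gaussianReal,
    charFun_of_isStationarySolution_pdDrift hlam hcf hcg hS hπ,
    Real.coe_toNNReal _ (inv_pos.2 hw).le] at h
  have h' : Real.exp (-((k ^ 2 / cf + cg⁻¹)⁻¹ / 2)) = Real.exp (-(S 0 0 / 2)) := by
    apply Complex.ofReal_injective
    simpa [quadForm, Fin.sum_univ_two] using h
  have := Real.exp_injective h'
  linarith

/-- The relation between the noise covariance `B Bᵀ` and the parameters forced by the target
marginal. -/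
theorem noise_relation_of_xMarginal_eq_gaussTarget {lam cf cg k : ℝ} (hlam : 0 < lam)
    (hcf : 0 < cf) (hcg : 0 < cg) {B : Matrix (Fin 2) (Fin 2) ℝ}
    {π : Measure (EuclideanSpace ℝ (Fin 2))}
    (hπ : IsStationarySolution (pdDrift lam cf cg k) B π)
    (hx : xMarginal π = gaussTarget cf cg k) :
    (cg⁻¹ + lam * cf) * (lam * cf) =
      (B * Bᵀ) 0 0 / 2 * ((cg⁻¹ + lam * cf) * (lam * cf) + lam * k ^ 2) -
        k * (B * Bᵀ) 0 1 * (lam * cf) + k ^ 2 * (B * Bᵀ) 1 1 / 2 := by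
  obtain ⟨M, hM⟩ := exists_lyapunov_pdMatrix hlam hcf hcg k B
  have h00 := covariance_of_xMarginal_eq_gaussTarget hlam hcf hcg hM hπ hx
  have hsymm : (M * Mᵀ) 1 0 = (M * Mᵀ) 0 1 := by
    rw [← Matrix.transpose_apply (M * Mᵀ) 0 1, Matrix.transpose_mul, Matrix.transpose_transpose]
  generalize M * Mᵀ = S at hM h00 hsymm
  generalize B * Bᵀ = D at hM
  have hw : 0 < k ^ 2 / cf + cg⁻¹ := by positivity
  -- The target variance in polynomial form: $S_{00}\det A_{\mathrm{PD}}=\lambda c_f$.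
  have e0 : S 0 0 * (lam * k ^ 2 + cg⁻¹ * (lam * cf)) = lam * cf := by
    rw [h00, inv_mul_eq_iff_eq_mul₀ hw.ne']
    field_simp
  have e1 := congrFun (congrFun hM 0) 0
  have e2 := congrFun (congrFun hM 0) 1
  have e3 := congrFun (congrFun hM 1) 1
  simp [pdMatrix, Matrix.mul_apply, Matrix.vecMul, dotProduct, Fin.sum_univ_two, hsymm] at e1 e2 e3
  -- The coefficients eliminate $S_{01}$ and $S_{11}$ from the three scalar Lyapunov equations.
  linear_combination (-(cg⁻¹ + lam * cf)) * e0 +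
    (1 / 2 * ((cg⁻¹ + lam * cf) * (lam * cf) + lam * k ^ 2)) * e1 - k * (lam * cf) * e2 +
    k ^ 2 / 2 * e3

theorem mainTheorem8 (lam : ℝ) (hlam : 0 < lam) :
    (∀ (B : Matrix (Fin 2) (Fin 2) ℝ) (cf cg k : ℝ), 0 < cf → 0 < cg → k ≠ 0 →
      ∃! π : Measure (EuclideanSpace ℝ (Fin 2)),
        IsStationarySolution (pdDrift lam cf cg k) B π) ∧
    ¬ ∃ B : Matrix (Fin 2) (Fin 2) ℝ, ∀ cf cg k : ℝ, 0 < cf → 0 < cg → k ≠ 0 →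
      ∃ π : Measure (EuclideanSpace ℝ (Fin 2)),
        IsStationarySolution (pdDrift lam cf cg k) B π ∧
          xMarginal π = gaussTarget cf cg k := by
  refine ⟨fun B cf cg k hcf hcg _ =>
    existsUnique_isStationarySolution_pdDrift hlam hcf hcg k B, ?_⟩
  rintro ⟨B, hB⟩
  have key : ∀ cg k : ℝ, 0 < cg → k ≠ 0 → (cg⁻¹ + 1) =
      (B * Bᵀ) 0 0 / 2 * ((cg⁻¹ + 1) + lam * k ^ 2) - k * (B * Bᵀ) 0 1 +
        k ^ 2 * (B * Bᵀ) 1 1 / 2 := fun cg k hcg hk => by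
    -- Choosing $c_f=\lambda^{-1}$ makes $\lambda c_f=1$ and leaves a relation affine in $c_g^{-1}$.
    obtain ⟨π, hπ, hx⟩ := hB lam⁻¹ cg k (inv_pos.2 hlam) hcg hk
    simpa [mul_inv_cancel₀ hlam.ne'] using
      noise_relation_of_xMarginal_eq_gaussTarget hlam (inv_pos.2 hlam) hcg hπ hx
  -- The first two instances differ only in $c_g^{-1}=1,2$ and give $D_{00}=2$; the first and third
  -- differ only in the sign of $k$, so their sum removes $D_{01}$.
  have h1 := key 1 1 one_pos one_ne_zero
  have h2 := key 2⁻¹ 1 (by norm_num) one_ne_zero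
  have h3 := key 1 (-1) one_pos (by norm_num)
  have hd : 0 ≤ (B * Bᵀ) 1 1 := by
    simp only [Matrix.mul_apply, Matrix.transpose_apply, Fin.sum_univ_two]
    nlinarith [sq_nonneg (B 1 0), sq_nonneg (B 1 1)]
  norm_num at h1 h2 h3
  have ha : (B * Bᵀ) 0 0 = 2 := by linarith
  rw [ha] at h1 h3
  linarith

end PrimalDual
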